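/- Let $n\ge 1$, let $\mathbb D^n$ be the open unit polydisc in $\mathbb C^n$, and let $\mathcal E_*$ be a complex Hilbert space. A function $K:\mathbb D^n\times\mathbb D^n\to\mathcal B(\mathcal E_*)$ is called a kernel (written $K\ge 0$) if $\sum_{i,j=1}^m\langle K(\boldsymbol z_i,\boldsymbol z_j)\eta_j,\eta_i\rangle\ge 0$ for all $m\ge1$, $\boldsymbol z_1,\dots,\boldsymbol z_m\in\mathbb D^n$ and $\eta_1,\dots,\eta_m\in\mathcal E_*$. Let $\mathbb S_n(\boldsymbol z,\boldsymbol w)=\prod_{i=1}^n(1-z_i\bar w_i)^{-1}$ be the Szegő kernel of $\mathbb D^n$. For a Hilbert space $\mathcal E$, a function $\Theta:\mathbb D^n\to\mathcal B(\mathcal E,\mathcal E_*)$ is a Schur–Agler function, $\Theta\in\mathcal{SA}(\mathbb D^n,\mathcal B(\mathcal E,\mathcal E_*))$, if it is analytic on $\mathbb D^n$, with power series $\Theta(\boldsymbol z)=\sum_{\boldsymbol k\in\mathbb Z_+^n}\Theta_{\boldsymbol k}\boldsymbol z^{\boldsymbol k}$, and for every Hilbert space $\mathcal H$ and all pairwise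 commuting operators $T_1,\dots,T_n\in\mathcal B(\mathcal H)$ with $\|T_i\|<1$ the operator $\Theta(T)=\sum_{\boldsymbol k}\Theta_{\boldsymbol k}\otimes T_1^{k_1}\cdots T_n^{k_n}$ from $\mathcal E\otimes\mathcal H$ to $\mathcal E_*\otimes\mathcal H$ (Hilbert space tensor products) satisfies $\|\Theta(T)\|\le 1$. Theorem. Let $K:\mathbb D^n\times\mathbb D^n\to\mathcal B(\mathcal E_*)$ be a kernel (not assumed to be analytic in its first variable). Then there exist a Hilbert space $\mathcal E$ and a Schur–Agler function $\Theta\in\mathcal{SA}(\mathbb D^n,\mathcal B(\mathcal E,\mathcal E_*))$ such that $$K(\boldsymbol z,\boldsymbol w)=\mathbb S_n(\boldsymbol z,\boldsymbol w)\,\bigl(I-\Theta(\boldsymbol z)\Theta(\boldsymbol w)^*\bigr)=\frac{I-\Theta(\boldsymbol z)\Theta(\boldsymbol w)^*}{\prod_{i=1}^n(1-z_i\bar w_i)}\qquad(\boldsymbol z,\boldsymbol w\in\mathbb D^n)$$ if and only if both of the following conditions hold: 1. there are $\mathcal B(\mathcal E_*)$-valued kernels $K_1,\dots,K_n$ on $\mathbb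 D^n$ such that $$K(\boldsymbol z,\boldsymbol w)=\sum_{i=1}^n\frac{1}{\prod_{j\ne i}(1-z_j\bar w_j)}\,K_i(\boldsymbol z,\boldsymbol w)\qquad(\boldsymbol z,\boldsymbol w\in\mathbb D^n);$$ 2. the function $(\boldsymbol z,\boldsymbol w)\mapsto I_{\mathcal E_*}-\mathbb S_n(\boldsymbol z,\boldsymbol w)^{-1}K(\boldsymbol z,\boldsymbol w)=I_{\mathcal E_*}-\prod_{i=1}^n(1-z_i\bar w_i)\,K(\boldsymbol z,\boldsymbol w)$ is a kernel on $\mathbb D^n$. -/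

import Mathlib

open scoped TensorProduct ComplexConjugate ComplexOrder

universe u

/-- The open unit polydisc `𝔻ⁿ` in `ℂⁿ`. -/
def polydisc (n : ℕ) : Set (Fin n → ℂ) := {z | ∀ i, ‖z i‖ < 1}

/-- A function `K : X × X → B(E)` is a (positive) kernel, `K ≥ 0`, if
`∑ i j, ⟨K (x i) (x j) (η j), η i⟩ ≥ 0` for all finite families of points `x i` and vectors `η i`.
Mathlib's inner product is linear in its second argument, hence the order of the arguments;
`0 ≤ c` for a complex number `c` means that `c` is real and nonnegative. -/
def IsPosKernel {X E : Type*} [NormedAddCommGroup E] [InnerProductSpace ℂ E]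
    (K : X → X → (E →L[ℂ] E)) : Prop :=
  ∀ (m : ℕ) (x : Fin m → X) (η : Fin m → E),
    (0 : ℂ) ≤ ∑ i, ∑ j, inner ℂ (η i) (K (x i) (x j) (η j))

/-- The Szegő kernel `𝕊ₙ(z, w) = ∏ i, 1 / (1 - z i * conj (w i))` of the polydisc. -/
noncomputable def szegoKernel {n : ℕ} (z w : polydisc n) : ℂ :=
  ∏ i, 1 / (1 - z.1 i * conj (w.1 i))

/-- The Hilbert space tensor product: the completion of the algebraic tensor product in the
inner product determined by `⟨x ⊗ y, x' ⊗ y'⟩ = ⟨x, x'⟩ ⟨y, y'⟩`. -/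
abbrev HilbertTensor (E H : Type*) [NormedAddCommGroup E] [InnerProductSpace ℂ E]
    [NormedAddCommGroup H] [InnerProductSpace ℂ H] : Type _ :=
  UniformSpace.Completion (E ⊗[ℂ] H)

/-- The bounded operator `A ⊗ B` between Hilbert space tensor products. -/
noncomputable def tensorOp {E F H : Type*} [NormedAddCommGroup E] [InnerProductSpace ℂ E]
    [NormedAddCommGroup F] [InnerProductSpace ℂ F] [NormedAddCommGroup H] [InnerProductSpace ℂ H]
    (A : E →L[ℂ] F) (B : H →L[ℂ] H) : HilbertTensor E H →L[ℂ] HilbertTensor F H :=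
  (TensorProduct.mapL A B).completion

/-- The monomial `T ^ k = T₁ ^ k₁ ⋯ Tₙ ^ kₙ` in a tuple of operators. -/
noncomputable def monomialOp {n : ℕ} {H : Type*} [NormedAddCommGroup H] [InnerProductSpace ℂ H]
    (T : Fin n → (H →L[ℂ] H)) (k : Fin n → ℕ) : H →L[ℂ] H :=
  (List.ofFn fun i => T i ^ k i).prod

/-- `Θ` belongs to the Schur–Agler class of the polydisc with values in `B(E, F)`: it is analytic
on the polydisc and, with `Θ(z) = ∑ k, c k z ^ k` its power series there, for every tuple `T` of
commuting strict contractions on a Hilbert space the operator `Θ(T) = ∑ k, c k ⊗ T ^ k` (the series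
converging unconditionally in operator norm) satisfies `‖Θ(T)‖ ≤ 1`. Only the values of `Θ` on the
polydisc matter. -/
structure IsSchurAgler {n : ℕ} {E F : Type u}
    [NormedAddCommGroup E] [InnerProductSpace ℂ E]
    [NormedAddCommGroup F] [InnerProductSpace ℂ F]
    (Θ : (Fin n → ℂ) → (E →L[ℂ] F)) : Prop where
  analytic : AnalyticOnNhd ℂ Θ (polydisc n)
  vonNeumann : ∃ c : (Fin n → ℕ) → (E →L[ℂ] F),
    (∀ z ∈ polydisc n, HasSum (fun k => (∏ i, z i ^ k i) • c k) (Θ z)) ∧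
    ∀ (H : Type u) [NormedAddCommGroup H] [InnerProductSpace ℂ H] [CompleteSpace H]
      (T : Fin n → (H →L[ℂ] H)), (∀ i j, Commute (T i) (T j)) → (∀ i, ‖T i‖ < 1) →
      ∃ S : HilbertTensor E H →L[ℂ] HilbertTensor F H,
        HasSum (fun k => tensorOp (c k) (monomialOp T k)) S ∧ ‖S‖ ≤ 1

/-- The de Branges–Rovnyak kernel
`K_Θ(z, w) = (I - Θ(z) Θ(w)^*) / ∏ i, (1 - z i * conj (w i))` on the polydisc. -/
noncomputable def deBrangesRovnyakKernel {n : ℕ} {E F : Type*}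
    [NormedAddCommGroup E] [InnerProductSpace ℂ E] [CompleteSpace E]
    [NormedAddCommGroup F] [InnerProductSpace ℂ F] [CompleteSpace F]
    (Θ : (Fin n → ℂ) → (E →L[ℂ] F)) (z w : polydisc n) : F →L[ℂ] F :=
  szegoKernel z w • (ContinuousLinearMap.id ℂ F - Θ z.1 ∘L ContinuousLinearMap.adjoint (Θ w.1))

-- Put `D = 𝕊ₙ⁻¹ K`. The desired representation says `D(z,w) = I - Θ(z)Θ(w)^*`; multiplied by
-- `𝕊ₙ⁻¹`, condition 1 says `D(z,w) = ∑ i, (1 - z_i conj w_i) K_i(z,w)`, and condition 2 says that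
-- `I - D` is a kernel. The theorem is thus Agler's characterization of the Schur–Agler class, in
-- both directions.
--
-- From the decomposition to `Θ`: factor `I - D = B(z)^* B(w)` and `K_i = A_i(z)^* A_i(w)`. The
-- decomposition then equates the Gram matrices of the vectors `(η, conj z_i A_i(z)η)` and `(B(z)η,
-- A_i(z)η)`, so a contraction `V` carries the former to the latter (lurking isometry). The transfer
-- function of the colligation `V^*` takes the value `B(z)^*` on the polydisc
-- (`exists_isSchurAgler_of_decomposition`). It is Schur–Agler by an energy balance that survives
-- tensoring with commuting strict contractions (`isSchurAgler_transferFunction`). In particular no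
-- analyticity of `K` is needed beforehand.
--
-- From `Θ` to the decomposition: over finitely many nodes, suppose the matrix of `I - ΘΘ^*` lies
-- outside the closed cone of decomposable matrices. A separating functional yields a positive
-- matrix, hence Gram vectors, on which diagonal multiplication by the conjugate node coordinates is
-- contractive. The adjoints of these multiplications are commuting contractions, and von Neumann's
-- inequality for them contradicts separation (`IsSchurAgler.mem_closure_aglerCone`). Compactness
-- passes to all nodes at once (`mem_aglerCone_of_finite`), and the resulting scalar kernels on `𝔻ⁿ
-- × F` turn out to be sesquilinear and bounded in the vectors (`exists_operator_kernels`).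

universe v w

/-! ### Positive kernels and their factorizations -/

section Kernel

theorem IsPosKernel.sum_nonneg {X E ι : Type*} [NormedAddCommGroup E] [InnerProductSpace ℂ E]
    [Fintype ι] {K : X → X → (E →L[ℂ] E)} (hK : IsPosKernel K) (x : ι → X) (η : ι → E) :
    (0 : ℂ) ≤ ∑ i, ∑ j, inner ℂ (η i) (K (x i) (x j) (η j)) := by
  have h := hK (Fintype.card ι) (fun i => x ((Fintype.equivFin ι).symm i))
    (fun i => η ((Fintype.equivFin ι).symm i))
  rw [← (Fintype.equivFin ι).symm.sum_comp]
  simp_rw [← (Fintype.equivFin ι).symm.sum_comp (fun j => inner ℂ (η _) (K (x _) (x j) (η j)))]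
  exact h

/-- `IsPosKernel` does not postulate Hermitian symmetry; it follows by polarization, since the form
is real at `u` over `x` and `c • v` over `y`, for `c = 1` and `c = I`. -/
theorem IsPosKernel.conj_inner {X E : Type*} [NormedAddCommGroup E] [InnerProductSpace ℂ E]
    {K : X → X → (E →L[ℂ] E)} (hK : IsPosKernel K) (x y : X) (u v : E) :
    conj (inner ℂ u (K x y v)) = inner ℂ v (K y x u) := by
  have key : ∀ c : ℂ, (inner ℂ u (K x x u) + c * inner ℂ u (K x y v)
      + (conj c * inner ℂ v (K y x u) + conj c * c * inner ℂ v (K y y v))).im = 0 := by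
    intro c
    have h := hK 2 ![x, y] ![u, c • v]
    simp only [Fin.sum_univ_two, Matrix.cons_val_zero, Matrix.cons_val_one, map_smul,
      inner_smul_left, inner_smul_right, ← mul_assoc] at h
    rw [mul_comm (conj c) c]
    exact (Complex.le_def.1 h).2.symm
  have hx := (Complex.le_def.1 (hK 1 ![x] ![u])).2
  have hy := (Complex.le_def.1 (hK 1 ![y] ![v])).2
  have h1 := key 1
  have h2 := key Complex.I
  simp only [Fin.sum_univ_one, Matrix.cons_val_zero, Complex.zero_im] at hx hy
  simp [← hx, ← hy] at h1 h2
  apply Complex.ext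
  · rw [Complex.conj_re]; linarith
  · rw [Complex.conj_im]; linarith

theorem IsPosKernel.posSemidef {X E : Type*} [NormedAddCommGroup E] [InnerProductSpace ℂ E]
    [CompleteSpace E] {K : X → X → (E →L[ℂ] E)} (hK : IsPosKernel K) :
    (Matrix.of K).PosSemidef := by
  have tfae := (RKHS.posSemidef_tfae (K := Matrix.of K)).out 0 2
  refine tfae.2 ⟨?_, fun f => ?_⟩
  · ext x y v
    refine ext_inner_left ℂ fun w => ?_
    simp only [Matrix.conjTranspose_apply, ContinuousLinearMap.star_eq_adjoint,
      ContinuousLinearMap.adjoint_inner_right, Matrix.of_apply]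
    rw [← inner_conj_symm (K y x w) v, hK.conj_inner]
  · have h := hK.sum_nonneg (fun i : f.support => (i : X)) (fun i => f i)
    have h' := (Complex.le_def.1 h).1
    rw [← Complex.conj_re] at h'
    convert! h' using 1
    simp only [Finsupp.sum, map_sum, Matrix.of_apply, Complex.re_sum]
    rw [Finset.sum_comm, ← Finset.sum_coe_sort]
    refine Finset.sum_congr rfl fun i _ => ?_
    rw [← Finset.sum_coe_sort]
    refine Finset.sum_congr rfl fun j _ => ?_
    rw [← inner_conj_symm]
    rfl

/-- Kolmogorov factorization of a positive kernel. -/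
theorem IsPosKernel.exists_factor {X : Type v} {E : Type w} [NormedAddCommGroup E]
    [InnerProductSpace ℂ E] [CompleteSpace E] {K : X → X → (E →L[ℂ] E)} (hK : IsPosKernel K) :
    ∃ (G : Type (max v w)) (_ : NormedAddCommGroup G) (_ : InnerProductSpace ℂ G)
      (_ : CompleteSpace G) (A : X → E →L[ℂ] G), ∀ x y, K x y = (A x).adjoint ∘L A y := by
  have : Fact (Matrix.of K).PosSemidef := ⟨hK.posSemidef⟩
  refine ⟨RKHS.OfKernel (Matrix.of K), inferInstance, inferInstance, inferInstance,
    fun x => RKHS.kerFun _ x, fun x y => ?_⟩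
  rw [← RKHS.kernel_apply, RKHS.OfKernel.kernel_ofKernel]
  rfl

theorem isPosKernel_adjoint_comp {X E G : Type*} [NormedAddCommGroup E] [InnerProductSpace ℂ E]
    [CompleteSpace E] [NormedAddCommGroup G] [InnerProductSpace ℂ G] [CompleteSpace G]
    (A : X → E →L[ℂ] G) : IsPosKernel fun x y => (A x).adjoint ∘L A y := by
  intro m x η
  have : ∑ i, ∑ j, inner ℂ (η i) (((A (x i)).adjoint ∘L A (x j)) (η j))
      = inner ℂ (∑ i, A (x i) (η i)) (∑ j, A (x j) (η j)) := by
    rw [sum_inner]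
    simp only [inner_sum, ContinuousLinearMap.adjoint_inner_right,
      ContinuousLinearMap.comp_apply]
  rw [this, inner_self_eq_norm_sq_to_K]
  simp only [Complex.coe_algebraMap, ← Complex.ofReal_pow]
  exact Complex.zero_le_real.2 (sq_nonneg _)

/-- Scalar positive semidefinite kernels. -/
def IsPosScalar {Y : Type*} (l : Y → Y → ℂ) : Prop :=
  ∀ (m : ℕ) (y : Fin m → Y) (v : Fin m → ℂ),
    0 ≤ ∑ i, ∑ j, conj (v i) * l (y i) (y j) * v j

theorem IsPosScalar.sum_nonneg {Y ι : Type*} [Fintype ι] {l : Y → Y → ℂ} (hl : IsPosScalar l)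
    (y : ι → Y) (v : ι → ℂ) : 0 ≤ ∑ i, ∑ j, conj (v i) * l (y i) (y j) * v j := by
  have h := hl (Fintype.card ι) (fun i => y ((Fintype.equivFin ι).symm i))
    (fun i => v ((Fintype.equivFin ι).symm i))
  rw [← (Fintype.equivFin ι).symm.sum_comp]
  simp_rw [← (Fintype.equivFin ι).symm.sum_comp (fun j => conj (v _) * l (y _) (y j) * v j)]
  exact h

/-- A scalar kernel acts as a `B(ℂ)`-valued one; the Gram vectors are the images of `1` under its
Kolmogorov factors. The Gram space stays in the universe of `Y`. -/
theorem IsPosScalar.exists_gram {Y : Type v} {l : Y → Y → ℂ} (hl : IsPosScalar l) :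
    ∃ (G : Type v) (_ : NormedAddCommGroup G) (_ : InnerProductSpace ℂ G) (_ : CompleteSpace G)
      (f : Y → G), ∀ x y, l x y = inner ℂ (f x) (f y) := by
  have : IsPosKernel fun x y => l x y • ContinuousLinearMap.id ℂ ℂ := by
    intro m y v
    refine (hl m y v).trans_eq (Finset.sum_congr rfl fun i _ => Finset.sum_congr rfl fun j _ => ?_)
    simp only [RCLike.inner_apply', smul_apply, ContinuousLinearMap.id_apply, smul_eq_mul]
    ring
  obtain ⟨G, _, _, _, A, hA⟩ := this.exists_factor
  refine ⟨G, ‹_›, ‹_›, ‹_›, fun x => A x 1, fun x y => ?_⟩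
  have := congrArg (fun T => inner ℂ (1 : ℂ) (T 1)) (hA x y)
  rw [ContinuousLinearMap.comp_apply, ContinuousLinearMap.adjoint_inner_right] at this
  simpa using this

theorem isPosScalar_inner {Y G : Type*} [NormedAddCommGroup G] [InnerProductSpace ℂ G]
    (f : Y → G) : IsPosScalar fun x y => inner ℂ (f x) (f y) := by
  intro m y v
  have : ∑ i, ∑ j, conj (v i) * inner ℂ (f (y i)) (f (y j)) * v j
      = inner ℂ (∑ i, v i • f (y i)) (∑ j, v j • f (y j)) := by
    rw [sum_inner]
    simp only [inner_sum, inner_smul_left, inner_smul_right]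
    exact Finset.sum_congr rfl fun i _ => Finset.sum_congr rfl fun j _ => by ring
  rw [this, inner_self_eq_norm_sq_to_K]
  simp only [Complex.coe_algebraMap, ← Complex.ofReal_pow]
  exact Complex.zero_le_real.2 (sq_nonneg _)

/-- A contraction prescribed on a family of vectors, and zero on its orthogonal complement. -/
theorem exists_contraction_extend {J F G : Type*} [NormedAddCommGroup F] [InnerProductSpace ℂ F]
    [CompleteSpace F] [NormedAddCommGroup G] [InnerProductSpace ℂ G] [CompleteSpace G]
    (f : J → F) (g : J → G)
    (h : ∀ c : J →₀ ℂ, ‖Finsupp.linearCombination ℂ g c‖ ≤ ‖Finsupp.linearCombination ℂ f c‖) :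
    ∃ R : F →L[ℂ] G, ‖R‖ ≤ 1 ∧ (∀ j, R (f j) = g j) ∧
      ∀ x, (∀ j, inner ℂ (f j) x = 0) → R x = 0 := by
  let M : Submodule ℂ F := (LinearMap.range (Finsupp.linearCombination ℂ f)).topologicalClosure
  have : CompleteSpace M := (Submodule.isClosed_topologicalClosure _).completeSpace_coe
  have hM : ∀ c, Finsupp.linearCombination ℂ f c ∈ M := fun c =>
    Submodule.le_topologicalClosure _ ⟨c, rfl⟩
  let e : (J →₀ ℂ) →ₗ[ℂ] M := (Finsupp.linearCombination ℂ f).codRestrict M hM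
  have hd : DenseRange e := by
    intro x
    rw [closure_subtype]
    refine closure_mono ?_ x.2
    rintro _ ⟨c, rfl⟩
    exact ⟨⟨_, hM c⟩, ⟨c, rfl⟩, rfl⟩
  have hb : ∀ c, ‖Finsupp.linearCombination ℂ g c‖ ≤ 1 * ‖e c‖ := fun c => by
    rw [one_mul]; exact h c
  let R₀ : M →L[ℂ] G := (Finsupp.linearCombination ℂ g).extendOfNorm e
  have hR₀ : ‖R₀‖ ≤ 1 := LinearMap.opNorm_extendOfNorm_le hd zero_le_one hb
  refine ⟨R₀ ∘L M.orthogonalProjectionOnto, ?_, fun j => ?_, fun x hx => ?_⟩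
  · refine (ContinuousLinearMap.opNorm_comp_le _ _).trans ?_
    exact mul_le_one₀ hR₀ (norm_nonneg _) M.orthogonalProjectionOnto_norm_le
  · have h1 : f j = (e (Finsupp.single j 1) : F) := by simp [e]
    rw [ContinuousLinearMap.comp_apply, h1, Submodule.orthogonalProjectionOnto_mem_subspace_eq_self,
      LinearMap.extendOfNorm_eq hd ⟨1, hb⟩]
    simp
  · have : x ∈ Mᗮ := by
      rw [Submodule.orthogonal_closure, Submodule.mem_orthogonal]
      rintro _ ⟨c, rfl⟩
      rw [Finsupp.linearCombination_apply, Finsupp.sum_inner]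
      simp [hx, Finsupp.sum]
    rw [ContinuousLinearMap.comp_apply,
      Submodule.orthogonalProjectionOnto_apply_of_mem_orthogonal this, map_zero]

end Kernel

/-! ### Operators on Hilbert space tensor products -/

section TensorOp

variable {E F G H : Type*} [NormedAddCommGroup E] [InnerProductSpace ℂ E]
  [NormedAddCommGroup F] [InnerProductSpace ℂ F] [NormedAddCommGroup G] [InnerProductSpace ℂ G]
  [NormedAddCommGroup H] [InnerProductSpace ℂ H]

theorem tensorOp_coe (A : E →L[ℂ] F) (B : H →L[ℂ] H) (x : E ⊗[ℂ] H) :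
    tensorOp A B (x : HilbertTensor E H) = (TensorProduct.mapL A B x : F ⊗[ℂ] H) :=
  ContinuousLinearMap.completion_apply_coe _ x

/-- Operators out of a Hilbert space tensor product agree if they agree on elementary tensors. -/
theorem HilbertTensor.ext {V : Type*} [NormedAddCommGroup V] [NormedSpace ℂ V]
    {S S' : HilbertTensor E H →L[ℂ] V}
    (h : ∀ (x : E) (y : H), S ((x ⊗ₜ[ℂ] y : E ⊗[ℂ] H) : HilbertTensor E H)
      = S' ((x ⊗ₜ[ℂ] y : E ⊗[ℂ] H) : HilbertTensor E H)) : S = S' := by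
  ext x
  induction x using UniformSpace.Completion.induction_on with
  | hp => exact isClosed_eq S.continuous S'.continuous
  | ih a =>
    induction a using TensorProduct.induction_on with
    | zero => rw [UniformSpace.Completion.coe_zero, map_zero, map_zero]
    | tmul x y => exact h x y
    | add x y hx hy => rw [UniformSpace.Completion.coe_add, map_add, map_add, hx, hy]

theorem tensorOp_comp (A : F →L[ℂ] G) (A' : E →L[ℂ] F) (B B' : H →L[ℂ] H) :
    tensorOp A B ∘L tensorOp A' B' = tensorOp (A ∘L A') (B ∘L B') := by
  refine HilbertTensor.ext fun x y => ?_
  simp only [ContinuousLinearMap.comp_apply, tensorOp_coe, TensorProduct.mapL_tmul]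

theorem tensorOp_add_left (A A' : E →L[ℂ] F) (B : H →L[ℂ] H) :
    tensorOp (A + A') B = tensorOp A B + tensorOp A' B := by
  refine HilbertTensor.ext fun x y => ?_
  simp only [add_apply, tensorOp_coe, TensorProduct.mapL_tmul,
    ← UniformSpace.Completion.coe_add, TensorProduct.add_tmul]

theorem tensorOp_zero_left (B : H →L[ℂ] H) : tensorOp (0 : E →L[ℂ] F) B = 0 := by
  refine HilbertTensor.ext fun x y => ?_
  rw [tensorOp_coe]; simp

theorem tensorOp_sum_left {ι : Type*} (s : Finset ι) (A : ι → E →L[ℂ] F) (B : H →L[ℂ] H) :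
    tensorOp (∑ i ∈ s, A i) B = ∑ i ∈ s, tensorOp (A i) B := by
  classical
  induction s using Finset.induction_on with
  | empty => simp [tensorOp_zero_left]
  | insert i s hi ih => rw [Finset.sum_insert hi, Finset.sum_insert hi, tensorOp_add_left, ih]

theorem tensorOp_id : tensorOp (ContinuousLinearMap.id ℂ E) (ContinuousLinearMap.id ℂ H)
    = ContinuousLinearMap.id ℂ _ := by
  refine HilbertTensor.ext fun x y => ?_
  simp [tensorOp_coe]

theorem norm_tensorOp_le (A : E →L[ℂ] F) (B : H →L[ℂ] H) : ‖tensorOp A B‖ ≤ ‖A‖ * ‖B‖ := by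
  refine ContinuousLinearMap.opNorm_le_bound _ (by positivity) fun x => ?_
  induction x using UniformSpace.Completion.induction_on with
  | hp => exact isClosed_le (by fun_prop) (by fun_prop)
  | ih a =>
    rw [tensorOp_coe, UniformSpace.Completion.norm_coe, UniformSpace.Completion.norm_coe]
    exact (ContinuousLinearMap.le_opNorm _ _).trans
      (mul_le_mul_of_nonneg_right (TensorProduct.norm_mapL_le A B) (norm_nonneg _))

theorem adjoint_tensorOp [CompleteSpace E] [CompleteSpace F] [CompleteSpace H]
    (A : E →L[ℂ] F) (B : H →L[ℂ] H) :
    (tensorOp A B).adjoint = tensorOp A.adjoint B.adjoint := by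
  refine HilbertTensor.ext fun x y => ?_
  refine ext_inner_left ℂ fun v => ?_
  rw [ContinuousLinearMap.adjoint_inner_right]
  induction v using UniformSpace.Completion.induction_on with
  | hp => exact isClosed_eq (by fun_prop) (by fun_prop)
  | ih a =>
    induction a using TensorProduct.induction_on with
    | zero => rw [UniformSpace.Completion.coe_zero, map_zero, inner_zero_left, inner_zero_left]
    | tmul a b =>
      simp only [tensorOp_coe, TensorProduct.mapL_tmul, UniformSpace.Completion.inner_coe,
        TensorProduct.inner_tmul, ContinuousLinearMap.adjoint_inner_right]
    | add a b ha hb =>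
      simp only [UniformSpace.Completion.coe_add, map_add, inner_add_left, ha, hb]

/-- Lets an identity `∑ Q^* Q = 1` become a Pythagorean identity on the completed tensor product,
without identifying that product with a direct sum. -/
theorem inner_tensorOp_self [CompleteSpace E] [CompleteSpace F] [CompleteSpace H]
    (A : E →L[ℂ] F) (g : HilbertTensor E H) :
    (‖tensorOp A (ContinuousLinearMap.id ℂ H) g‖ : ℂ) ^ 2
      = inner ℂ g (tensorOp (A.adjoint ∘L A) (ContinuousLinearMap.id ℂ H) g) := by
  have h : tensorOp (A.adjoint ∘L A) (ContinuousLinearMap.id ℂ H)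
      = (tensorOp A (ContinuousLinearMap.id ℂ H)).adjoint
        ∘L tensorOp A (ContinuousLinearMap.id ℂ H) := by
    rw [adjoint_tensorOp, tensorOp_comp, ContinuousLinearMap.adjoint_id]
    rfl
  rw [h, ContinuousLinearMap.comp_apply, ContinuousLinearMap.adjoint_inner_right,
    inner_self_eq_norm_sq_to_K]
  rfl

/-- A finite family of operators with `∑ i, (Q i)^* (Q i) = 1` preserves norms after tensoring. -/
theorem sum_norm_sq_tensorOp {ι : Type*} [Fintype ι] [CompleteSpace E] [CompleteSpace F]
    [CompleteSpace H] (Q : ι → E →L[ℂ] F)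
    (hQ : ∑ i, (Q i).adjoint ∘L Q i = ContinuousLinearMap.id ℂ E) (g : HilbertTensor E H) :
    ∑ i, ‖tensorOp (Q i) (ContinuousLinearMap.id ℂ H) g‖ ^ 2 = ‖g‖ ^ 2 := by
  have h : ((∑ i, ‖tensorOp (Q i) (ContinuousLinearMap.id ℂ H) g‖ ^ 2 : ℝ) : ℂ)
      = ((‖g‖ ^ 2 : ℝ) : ℂ) := by
    push_cast
    simp only [inner_tensorOp_self]
    rw [← inner_sum, ← sum_apply, ← tensorOp_sum_left, hQ, tensorOp_id,
      ContinuousLinearMap.id_apply, inner_self_eq_norm_sq_to_K]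
    rfl
  exact_mod_cast h

theorem norm_sq_tensorOp_add [CompleteSpace E] [CompleteSpace F] [CompleteSpace G]
    [CompleteSpace H] (Q : E →L[ℂ] F) (Q' : E →L[ℂ] G)
    (hQ : Q.adjoint ∘L Q + Q'.adjoint ∘L Q' = ContinuousLinearMap.id ℂ E)
    (g : HilbertTensor E H) :
    ‖tensorOp Q (ContinuousLinearMap.id ℂ H) g‖ ^ 2
      + ‖tensorOp Q' (ContinuousLinearMap.id ℂ H) g‖ ^ 2 = ‖g‖ ^ 2 := by
  have h : ((‖tensorOp Q (ContinuousLinearMap.id ℂ H) g‖ ^ 2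
      + ‖tensorOp Q' (ContinuousLinearMap.id ℂ H) g‖ ^ 2 : ℝ) : ℂ) = ((‖g‖ ^ 2 : ℝ) : ℂ) := by
    push_cast
    simp only [inner_tensorOp_self]
    rw [← inner_add_right, ← add_apply, ← tensorOp_add_left, hQ, tensorOp_id,
      ContinuousLinearMap.id_apply, inner_self_eq_norm_sq_to_K]
    rfl
  exact_mod_cast h

end TensorOp

/-! ### Monomials in commuting operators and sums over multi-indices -/

section Monomial

variable {H : Type*} [NormedAddCommGroup H] [InnerProductSpace ℂ H]

theorem monomialOp_zero {n : ℕ} (T : Fin n → (H →L[ℂ] H)) : monomialOp T 0 = 1 := by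
  simp [monomialOp, List.ofFn_const]

theorem monomialOp_succ {n : ℕ} (T : Fin (n + 1) → (H →L[ℂ] H)) (k : Fin (n + 1) → ℕ) :
    monomialOp T k = T 0 ^ k 0 * monomialOp (fun i => T i.succ) fun i => k i.succ := by
  simp [monomialOp, List.ofFn_succ]

theorem monomialOp_add_single {n : ℕ} (T : Fin n → (H →L[ℂ] H))
    (hT : ∀ i j, Commute (T i) (T j)) (k : Fin n → ℕ) (i : Fin n) :
    monomialOp T (k + Pi.single i 1) = T i * monomialOp T k := by
  induction n with
  | zero => exact i.elim0
  | succ n ih =>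
    rw [monomialOp_succ, monomialOp_succ]
    induction i using Fin.cases with
    | zero =>
      have h : (fun j : Fin n => (k + Pi.single 0 1 : Fin (n + 1) → ℕ) j.succ) = fun j => k j.succ := by
        ext j; simp
      rw [h, Pi.add_apply, Pi.single_eq_same, pow_succ', mul_assoc]
    | succ i =>
      have h : (fun j : Fin n => (k + Pi.single i.succ 1 : Fin (n + 1) → ℕ) j.succ)
          = (fun j => k j.succ) + Pi.single i 1 := by
        ext j; simp [Pi.single_apply]
      have h0 : (k + Pi.single i.succ 1 : Fin (n + 1) → ℕ) 0 = k 0 := by simp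
      rw [h, h0, ih (fun i => T i.succ) (fun i j => hT _ _), ← mul_assoc, ← mul_assoc,
        ((hT 0 i.succ).pow_left (k 0)).eq]

theorem norm_monomialOp_le {n : ℕ} (T : Fin n → (H →L[ℂ] H)) (k : Fin n → ℕ) :
    ‖monomialOp T k‖ ≤ ∏ i, ‖T i‖ ^ k i := by
  induction n with
  | zero =>
    rw [Finset.univ_eq_empty, Finset.prod_empty]
    exact ContinuousLinearMap.norm_id_le
  | succ n ih =>
    rw [monomialOp_succ, Fin.prod_univ_succ]
    refine (norm_mul_le _ _).trans (mul_le_mul ?_ (ih _ _) (norm_nonneg _) (by positivity))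
    rcases Nat.eq_zero_or_pos (k 0) with h | h
    · rw [h, pow_zero, pow_zero]
      exact ContinuousLinearMap.norm_id_le
    · exact norm_pow_le' _ h

/-- The effect of a monomial on a common eigenvector of the adjoints. -/
theorem inner_monomialOp {n : ℕ} (T : Fin n → (H →L[ℂ] H)) (k : Fin n → ℕ) (μ : Fin n → ℂ)
    (f : H) (hf : ∀ i h, inner ℂ f (T i h) = μ i * inner ℂ f h) (h : H) :
    inner ℂ f (monomialOp T k h) = (∏ i, μ i ^ k i) * inner ℂ f h := by
  have hpow : ∀ i (m : ℕ) h, inner ℂ f ((T i ^ m) h) = μ i ^ m * inner ℂ f h := by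
    intro i m
    induction m with
    | zero => simp
    | succ m ih => intro h; rw [pow_succ, mul_apply_eq_comp, ih, hf]; ring
  induction n with
  | zero => simp [monomialOp]
  | succ n ih =>
    rw [monomialOp_succ, Fin.prod_univ_succ, mul_apply_eq_comp, hpow,
      ih (fun i => T i.succ) (fun i => k i.succ) (fun i => μ i.succ) (fun i => hf _)
        (fun i => hpow _)]
    ring

theorem summable_prod_pow {n : ℕ} (r : Fin n → ℝ) (h0 : ∀ i, 0 ≤ r i) (h1 : ∀ i, r i < 1) :
    Summable fun k : Fin n → ℕ => ∏ i, r i ^ k i := by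
  induction n with
  | zero => exact (hasSum_fintype _).summable
  | succ n ih =>
    rw [← (Fin.consEquiv fun _ => ℕ).summable_iff]
    have := (summable_geometric_of_lt_one (h0 0) (h1 0)).mul_of_nonneg
      (ih (fun i => r i.succ) (fun i => h0 _) fun i => h1 _)
      (fun m => pow_nonneg (h0 0) m)
      fun k => Finset.prod_nonneg fun i _ => pow_nonneg (h0 _) _
    refine this.congr fun p => ?_
    simp [Fin.prod_univ_succ, Fin.consEquiv]

theorem sub_single_add_single {n : ℕ} {k : Fin n → ℕ} {i : Fin n} (hi : k i ≠ 0) :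
    k - Pi.single i 1 + Pi.single i 1 = k := by
  ext j
  rcases eq_or_ne j i with rfl | hj
  · simp; omega
  · simp [hj]

/-- Adding `Pi.single i 1` is injective with range `{k | k i ≠ 0}`; the guard `k i = 0` discards the
indices where the truncated subtraction would be meaningless. -/
theorem hasSum_shift {n : ℕ} {W : Type*} [AddCommMonoid W] [TopologicalSpace W]
    {f : (Fin n → ℕ) → W} {s : W} (hf : HasSum f s) (i : Fin n) :
    HasSum (fun k : Fin n → ℕ => if k i = 0 then 0 else f (k - Pi.single i 1)) s := by
  have hinj : Function.Injective fun k : Fin n → ℕ => k + Pi.single i 1 :=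
    add_left_injective _
  refine (hinj.hasSum_iff fun k hk => ?_).1 ?_
  · exact if_pos (by_contra fun h0 => hk ⟨k - Pi.single i 1, sub_single_add_single h0⟩)
  · convert! hf using 1
    funext k
    simp

/-- Turns a recursion on coefficients into an equation between sums. It serves both for the
fixed-point equation of the state series and for the output series. -/
theorem hasSum_shift_sum {n : ℕ} {W W' : Type*} [NormedAddCommGroup W] [NormedSpace ℂ W]
    [NormedAddCommGroup W'] [NormedSpace ℂ W'] {f : (Fin n → ℕ) → W} {s : W} (hf : HasSum f s)
    (a : W') (M : Fin n → W →L[ℂ] W') :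
    HasSum (fun k : Fin n → ℕ => (if k = 0 then a else 0)
      + ∑ i, if k i = 0 then 0 else M i (f (k - Pi.single i 1))) (a + ∑ i, M i s) :=
  (hasSum_ite_eq 0 a).add
    (hasSum_sum fun i _ => hasSum_shift (f := fun k => M i (f k)) ((M i).hasSum hf) i)

end Monomial

/-! ### Transfer functions of contractive colligations -/

section Transfer

variable {n : ℕ} {E F K : Type*} [NormedAddCommGroup E] [InnerProductSpace ℂ E]
  [NormedAddCommGroup F] [InnerProductSpace ℂ F] [NormedAddCommGroup K] [InnerProductSpace ℂ K]

/-- The homogeneous components of the coefficients of `(1 - ∑ i, z i • D i)⁻¹ ∘ γ`. -/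
noncomputable def resolventLevel (D : Fin n → K →L[ℂ] K) (γ : E →L[ℂ] K) :
    ℕ → (Fin n → ℕ) → (E →L[ℂ] K)
  | 0, k => if k = 0 then γ else 0
  | m + 1, k => ∑ i, if k i = 0 then 0 else D i ∘L resolventLevel D γ m (k - Pi.single i 1)

/-- The power series coefficients of `(1 - ∑ i, z i • D i)⁻¹ ∘ γ`. -/
noncomputable def resolventCoeff (D : Fin n → K →L[ℂ] K) (γ : E →L[ℂ] K) (k : Fin n → ℕ) :
    E →L[ℂ] K :=
  resolventLevel D γ (∑ i, k i) k

theorem resolventCoeff_eq (D : Fin n → K →L[ℂ] K) (γ : E →L[ℂ] K) (k : Fin n → ℕ) :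
    resolventCoeff D γ k = (if k = 0 then γ else 0)
      + ∑ i, if k i = 0 then 0 else D i ∘L resolventCoeff D γ (k - Pi.single i 1) := by
  by_cases hk : k = 0
  · subst hk
    simp [resolventCoeff, resolventLevel]
  · obtain ⟨m, hm⟩ : ∃ m, ∑ i, k i = m + 1 := by
      refine Nat.exists_eq_succ_of_ne_zero fun h => hk ?_
      ext i
      exact Finset.sum_eq_zero_iff.1 h i (Finset.mem_univ i)
    rw [if_neg hk, zero_add, resolventCoeff, hm, resolventLevel]
    refine Finset.sum_congr rfl fun i _ => ?_
    split_ifs with hi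
    · rfl
    · have h1 := sub_single_add_single hi
      have h2 : ∑ j, (k - Pi.single i 1 : Fin n → ℕ) j = m := by
        have : ∑ j, (k - Pi.single i 1 + Pi.single i 1 : Fin n → ℕ) j = m + 1 := by rw [h1, hm]
        simp only [Pi.add_apply, Finset.sum_add_distrib, Finset.sum_pi_single',
          Finset.mem_univ, if_true] at this
        simpa [Pi.single_apply] using this
      rw [resolventCoeff, h2]

/-- Orthogonal projections that decompose the identity. -/
structure IsProjectionFamily [CompleteSpace K] (P : Fin n → K →L[ℂ] K) : Prop where
  adjoint_eq : ∀ i, (P i).adjoint = P i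
  comp_self : ∀ i, P i ∘L P i = P i
  comp_ne : ∀ i j, i ≠ j → P i ∘L P j = 0
  sum_eq : ∑ i, P i = ContinuousLinearMap.id ℂ K

variable [CompleteSpace K]

theorem IsProjectionFamily.sum_norm_sq {P : Fin n → K →L[ℂ] K} (hP : IsProjectionFamily P)
    (x : K) : ∑ i, ‖P i x‖ ^ 2 = ‖x‖ ^ 2 := by
  have h : ((∑ i, ‖P i x‖ ^ 2 : ℝ) : ℂ) = ((‖x‖ ^ 2 : ℝ) : ℂ) := by
    push_cast
    have h1 : ∀ i, (‖P i x‖ : ℂ) ^ 2 = inner ℂ x (P i x) := by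
      intro i
      have := congrArg (fun T => T x) (hP.comp_self i)
      simp only [ContinuousLinearMap.comp_apply] at this
      conv_rhs => rw [← this, ← hP.adjoint_eq i, ContinuousLinearMap.adjoint_inner_right,
        hP.adjoint_eq i, inner_self_eq_norm_sq_to_K]
      rfl
    simp only [h1]
    rw [← inner_sum, ← sum_apply, hP.sum_eq, ContinuousLinearMap.id_apply,
      inner_self_eq_norm_sq_to_K]
    rfl
  exact_mod_cast h

theorem IsProjectionFamily.apply_sum {P : Fin n → K →L[ℂ] K} (hP : IsProjectionFamily P)
    (u : Fin n → K) (i : Fin n) : P i (∑ j, P j (u j)) = P i (u i) := by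
  rw [map_sum, Finset.sum_eq_single i]
  · exact congrArg (fun T => T (u i)) (hP.comp_self i)
  · intro j _ hj
    exact congrArg (fun T => T (u j)) (hP.comp_ne i j hj.symm)
  · simp

theorem IsProjectionFamily.norm_sq_sum {P : Fin n → K →L[ℂ] K} (hP : IsProjectionFamily P)
    (u : Fin n → K) : ‖∑ j, P j (u j)‖ ^ 2 = ∑ i, ‖P i (u i)‖ ^ 2 := by
  rw [← hP.sum_norm_sq]
  simp only [hP.apply_sum]

theorem IsProjectionFamily.norm_sum_smul_le {P : Fin n → K →L[ℂ] K} (hP : IsProjectionFamily P)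
    (z : Fin n → ℂ) : ‖∑ i, z i • P i‖ ≤ ‖z‖ := by
  refine ContinuousLinearMap.opNorm_le_bound _ (norm_nonneg _) fun x => ?_
  refine le_of_sq_le_sq ?_ (by positivity)
  have : (∑ i, z i • P i) x = ∑ i, P i (z i • x) := by simp
  rw [this, hP.norm_sq_sum, mul_pow, ← hP.sum_norm_sq x, Finset.mul_sum]
  refine Finset.sum_le_sum fun i _ => ?_
  rw [map_smul, norm_smul, mul_pow]
  gcongr
  exact norm_le_pi_norm z i

/-- No energy is gained from one level to the next: a coefficient of level `m + 1` is `δ` applied to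
a sum of mutually orthogonal pieces `P i (…)`, and after summing over `k` each shift disappears and
the pieces recombine by `∑ i, ‖P i y‖² = ‖y‖²`. Working in `ENNReal` removes all summability
questions. -/
theorem tsum_resolventLevel_le {P : Fin n → K →L[ℂ] K} (hP : IsProjectionFamily P)
    {δ : K →L[ℂ] K} (hδ : ‖δ‖ ≤ 1) {γ : E →L[ℂ] K} (hγ : ‖γ‖ ≤ 1) (x : E) (m : ℕ) :
    ∑' k, ENNReal.ofReal (‖resolventLevel (fun i => δ ∘L P i) γ m k x‖ ^ 2)
      ≤ ENNReal.ofReal (‖x‖ ^ 2) := by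
  induction m with
  | zero =>
    rw [tsum_eq_single 0]
    · refine ENNReal.ofReal_le_ofReal (pow_le_pow_left₀ (norm_nonneg _) ?_ 2)
      simpa [resolventLevel] using γ.le_of_opNorm_le hγ x
    · intro k hk
      simp [resolventLevel, hk]
  | succ m ih =>
    refine le_trans ?_ ih
    have hle : ∀ k : Fin n → ℕ,
        ENNReal.ofReal (‖resolventLevel (fun i => δ ∘L P i) γ (m + 1) k x‖ ^ 2)
          ≤ ∑ i, if k i = 0 then 0 else ENNReal.ofReal
            (‖P i (resolventLevel (fun i => δ ∘L P i) γ m (k - Pi.single i 1) x)‖ ^ 2) := by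
      intro k
      let v : Fin n → K := fun i => if k i = 0 then 0 else
        resolventLevel (fun i => δ ∘L P i) γ m (k - Pi.single i 1) x
      have h1 : resolventLevel (fun i => δ ∘L P i) γ (m + 1) k x = δ (∑ i, P i (v i)) := by
        simp only [resolventLevel, sum_apply, map_sum, v]
        refine Finset.sum_congr rfl fun i _ => ?_
        split_ifs <;> simp
      have h2 : ‖resolventLevel (fun i => δ ∘L P i) γ (m + 1) k x‖ ^ 2
          ≤ ∑ i, ‖P i (v i)‖ ^ 2 := by
        rw [h1, ← hP.norm_sq_sum]
        refine pow_le_pow_left₀ (norm_nonneg _) ?_ 2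
        exact (δ.le_of_opNorm_le hδ _).trans_eq (one_mul _)
      refine (ENNReal.ofReal_le_ofReal h2).trans ?_
      rw [ENNReal.ofReal_sum_of_nonneg fun i _ => by positivity]
      refine Finset.sum_le_sum fun i _ => ?_
      simp only [v]
      split_ifs <;> simp
    refine (ENNReal.tsum_le_tsum hle).trans ?_
    rw [Summable.tsum_finsetSum fun i _ => ENNReal.summable]
    have hs : ∀ i, ∑' k : Fin n → ℕ, (if k i = 0 then 0 else ENNReal.ofReal
        (‖P i (resolventLevel (fun i => δ ∘L P i) γ m (k - Pi.single i 1) x)‖ ^ 2))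
        = ∑' k, ENNReal.ofReal (‖P i (resolventLevel (fun i => δ ∘L P i) γ m k x)‖ ^ 2) :=
      fun i => (hasSum_shift (f := fun k => ENNReal.ofReal
        (‖P i (resolventLevel (fun i => δ ∘L P i) γ m k x)‖ ^ 2)) ENNReal.summable.hasSum i).tsum_eq
    simp only [hs]
    rw [← Summable.tsum_finsetSum fun i _ => ENNReal.summable]
    refine le_of_eq (tsum_congr fun k => ?_)
    rw [← ENNReal.ofReal_sum_of_nonneg fun i _ => by positivity, hP.sum_norm_sq]

/-- This uniform bound makes the series at `T` converge in operator norm, dominated by `∏ i, ‖T i‖ ^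
k i`. -/
theorem norm_resolventCoeff_le {P : Fin n → K →L[ℂ] K} (hP : IsProjectionFamily P)
    {δ : K →L[ℂ] K} (hδ : ‖δ‖ ≤ 1) {γ : E →L[ℂ] K} (hγ : ‖γ‖ ≤ 1) (k : Fin n → ℕ) :
    ‖resolventCoeff (fun i => δ ∘L P i) γ k‖ ≤ 1 := by
  refine ContinuousLinearMap.opNorm_le_bound _ zero_le_one fun x => ?_
  have h := (ENNReal.le_tsum k).trans (tsum_resolventLevel_le hP hδ hγ x (∑ i, k i))
  rw [ENNReal.ofReal_le_ofReal_iff (by positivity)] at h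
  rw [one_mul]
  exact le_of_sq_le_sq h (norm_nonneg _)

/-- The `i`-th component of the sum is `(1 ⊗ T i)(P i ⊗ 1) g`, so each orthogonal component of `g`
is contracted separately. -/
theorem norm_sum_tensorOp_le {H : Type*} [NormedAddCommGroup H] [InnerProductSpace ℂ H]
    [CompleteSpace H] {P : Fin n → K →L[ℂ] K} (hP : IsProjectionFamily P)
    (T : Fin n → (H →L[ℂ] H)) (hT : ∀ i, ‖T i‖ ≤ 1) (g : HilbertTensor K H) :
    ‖∑ i, tensorOp (P i) (T i) g‖ ≤ ‖g‖ := by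
  have hQ : ∑ i, (P i).adjoint ∘L P i = ContinuousLinearMap.id ℂ K := by
    simp only [hP.adjoint_eq, hP.comp_self, hP.sum_eq]
  refine le_of_sq_le_sq ?_ (norm_nonneg _)
  rw [← sum_norm_sq_tensorOp P hQ, ← sum_norm_sq_tensorOp P hQ g]
  refine Finset.sum_le_sum fun i _ => pow_le_pow_left₀ (norm_nonneg _) ?_ 2
  have h : tensorOp (P i) (ContinuousLinearMap.id ℂ H) (∑ j, tensorOp (P j) (T j) g)
      = tensorOp (ContinuousLinearMap.id ℂ K) (T i)
        (tensorOp (P i) (ContinuousLinearMap.id ℂ H) g) := by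
    rw [map_sum, Finset.sum_eq_single i]
    · rw [← ContinuousLinearMap.comp_apply, ← ContinuousLinearMap.comp_apply, tensorOp_comp,
        tensorOp_comp, hP.comp_self]
      rfl
    · intro j _ hj
      rw [← ContinuousLinearMap.comp_apply, tensorOp_comp, hP.comp_ne i j hj.symm,
        tensorOp_zero_left]
      rfl
    · simp
  rw [h]
  have h1 : ‖tensorOp (ContinuousLinearMap.id ℂ K) (T i)‖ ≤ 1 :=
    (norm_tensorOp_le _ _).trans
      (mul_le_one₀ ContinuousLinearMap.norm_id_le (norm_nonneg _) (hT i))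
  simpa using ContinuousLinearMap.le_of_opNorm_le _ h1 _

end Transfer

/-! ### Contractive colligations have Schur–Agler transfer functions -/

section SchurAgler

section Blocks

variable {E F K : Type*} [NormedAddCommGroup E] [InnerProductSpace ℂ E]
  [NormedAddCommGroup F] [InnerProductSpace ℂ F] [NormedAddCommGroup K] [InnerProductSpace ℂ K]

/-- The first inclusion into a Hilbert space direct sum. -/
noncomputable def prodInl (E K : Type*) [NormedAddCommGroup E] [InnerProductSpace ℂ E]
    [NormedAddCommGroup K] [InnerProductSpace ℂ K] : E →L[ℂ] WithLp 2 (E × K) :=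
  (WithLp.prodContinuousLinearEquiv 2 ℂ E K).symm.toContinuousLinearMap
    ∘L ContinuousLinearMap.inl ℂ E K

/-- The second inclusion into a Hilbert space direct sum. -/
noncomputable def prodInr (E K : Type*) [NormedAddCommGroup E] [InnerProductSpace ℂ E]
    [NormedAddCommGroup K] [InnerProductSpace ℂ K] : K →L[ℂ] WithLp 2 (E × K) :=
  (WithLp.prodContinuousLinearEquiv 2 ℂ E K).symm.toContinuousLinearMap
    ∘L ContinuousLinearMap.inr ℂ E K

theorem prodInl_apply (x : E) : prodInl E K x = WithLp.toLp 2 (x, 0) := rfl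

theorem prodInr_apply (x : K) : prodInr E K x = WithLp.toLp 2 (0, x) := rfl

theorem fstL_comp_prodInl : WithLp.fstL 2 ℂ E K ∘L prodInl E K = ContinuousLinearMap.id ℂ E := rfl

theorem fstL_comp_prodInr : WithLp.fstL 2 ℂ E K ∘L prodInr E K = 0 := rfl

theorem sndL_comp_prodInl : WithLp.sndL 2 ℂ E K ∘L prodInl E K = 0 := rfl

theorem sndL_comp_prodInr : WithLp.sndL 2 ℂ E K ∘L prodInr E K = ContinuousLinearMap.id ℂ K := rfl

theorem adjoint_fstL_add_adjoint_sndL [CompleteSpace E] [CompleteSpace K] :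
    (WithLp.fstL 2 ℂ E K).adjoint ∘L WithLp.fstL 2 ℂ E K
      + (WithLp.sndL 2 ℂ E K).adjoint ∘L WithLp.sndL 2 ℂ E K = ContinuousLinearMap.id ℂ _ := by
  ext1 y
  refine ext_inner_left ℂ fun x => ?_
  simp only [add_apply, ContinuousLinearMap.comp_apply, inner_add_right,
    ContinuousLinearMap.adjoint_inner_right, WithLp.prod_inner_apply,
    ContinuousLinearMap.id_apply]
  rfl

variable {H : Type*} [NormedAddCommGroup H] [InnerProductSpace ℂ H]

theorem tensorOp_comp_id_apply (A : F →L[ℂ] K) (A' : E →L[ℂ] F) (x : HilbertTensor E H) :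
    tensorOp (A ∘L A') (ContinuousLinearMap.id ℂ H) x
      = tensorOp A (ContinuousLinearMap.id ℂ H) (tensorOp A' (ContinuousLinearMap.id ℂ H) x) := by
  rw [← ContinuousLinearMap.comp_apply, tensorOp_comp]
  rfl

/-- This is `‖(U ⊗ 1) p‖ ≤ ‖p‖` in coordinates: the two coordinate maps satisfy `∑ Q^* Q = 1`, so
after tensoring they still compute the norm on both sides. -/
theorem norm_sq_tensorOp_blocks_le [CompleteSpace E] [CompleteSpace F] [CompleteSpace K]
    [CompleteSpace H] (U : WithLp 2 (E × K) →L[ℂ] WithLp 2 (F × K)) (hU : ‖U‖ ≤ 1)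
    (x : HilbertTensor E H) (h : HilbertTensor K H) :
    ‖tensorOp (WithLp.fstL 2 ℂ F K ∘L U ∘L prodInl E K) (ContinuousLinearMap.id ℂ H) x
        + tensorOp (WithLp.fstL 2 ℂ F K ∘L U ∘L prodInr E K) (ContinuousLinearMap.id ℂ H) h‖ ^ 2
      + ‖tensorOp (WithLp.sndL 2 ℂ F K ∘L U ∘L prodInl E K) (ContinuousLinearMap.id ℂ H) x
        + tensorOp (WithLp.sndL 2 ℂ F K ∘L U ∘L prodInr E K) (ContinuousLinearMap.id ℂ H) h‖ ^ 2
      ≤ ‖x‖ ^ 2 + ‖h‖ ^ 2 := by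
  set p : HilbertTensor (WithLp 2 (E × K)) H :=
    tensorOp (prodInl E K) (ContinuousLinearMap.id ℂ H) x
      + tensorOp (prodInr E K) (ContinuousLinearMap.id ℂ H) h with hp
  simp only [tensorOp_comp_id_apply, ← map_add]
  rw [← hp, norm_sq_tensorOp_add _ _ adjoint_fstL_add_adjoint_sndL]
  have h1 : tensorOp (WithLp.fstL 2 ℂ E K) (ContinuousLinearMap.id ℂ H) p = x := by
    rw [hp, map_add, ← tensorOp_comp_id_apply, ← tensorOp_comp_id_apply, fstL_comp_prodInl,
      fstL_comp_prodInr, tensorOp_id, tensorOp_zero_left]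
    simp
  have h2 : tensorOp (WithLp.sndL 2 ℂ E K) (ContinuousLinearMap.id ℂ H) p = h := by
    rw [hp, map_add, ← tensorOp_comp_id_apply, ← tensorOp_comp_id_apply, sndL_comp_prodInl,
      sndL_comp_prodInr, tensorOp_id, tensorOp_zero_left]
    simp
  have h3 := norm_sq_tensorOp_add (WithLp.fstL 2 ℂ E K) (WithLp.sndL 2 ℂ E K)
    adjoint_fstL_add_adjoint_sndL p
  rw [h1, h2] at h3
  rw [h3]
  refine pow_le_pow_left₀ (norm_nonneg _) ?_ 2
  have hU' : ‖tensorOp U (ContinuousLinearMap.id ℂ H)‖ ≤ 1 :=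
    (norm_tensorOp_le _ _).trans
      (mul_le_one₀ hU (norm_nonneg _) ContinuousLinearMap.norm_id_le)
  simpa using ContinuousLinearMap.le_of_opNorm_le _ hU' p

end Blocks

/-- The transfer function `α + β Z(z) (1 - δ Z(z))⁻¹ γ` of a colligation, `Z(z) = ∑ i, z i • P i`. -/
noncomputable def transferFunction {n : ℕ} {E F K : Type*} [NormedAddCommGroup E]
    [InnerProductSpace ℂ E] [NormedAddCommGroup F] [InnerProductSpace ℂ F] [NormedAddCommGroup K]
    [InnerProductSpace ℂ K] (P : Fin n → K →L[ℂ] K) (α : E →L[ℂ] F) (β : K →L[ℂ] F)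
    (γ : E →L[ℂ] K) (δ : K →L[ℂ] K) (z : Fin n → ℂ) : E →L[ℂ] F :=
  α + β ∘L (∑ i, z i • P i) ∘L Ring.inverse (1 - δ * ∑ i, z i • P i) ∘L γ

variable {n : ℕ} {E F K : Type*} [NormedAddCommGroup E] [InnerProductSpace ℂ E]
  [NormedAddCommGroup F] [InnerProductSpace ℂ F] [NormedAddCommGroup K] [InnerProductSpace ℂ K]

theorem mem_polydisc_iff {z : Fin n → ℂ} : z ∈ polydisc n ↔ ‖z‖ < 1 :=
  (pi_norm_lt_iff one_pos).symm

theorem isUnit_one_sub_mul [CompleteSpace K] {P : Fin n → K →L[ℂ] K} (hP : IsProjectionFamily P) {δ : K →L[ℂ] K}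
    (hδ : ‖δ‖ ≤ 1) {z : Fin n → ℂ} (hz : z ∈ polydisc n) : IsUnit (1 - δ * ∑ i, z i • P i) := by
  refine isUnit_one_sub_of_norm_lt_one ((norm_mul_le _ _).trans_lt ?_)
  calc ‖δ‖ * ‖∑ i, z i • P i‖ ≤ 1 * ‖z‖ :=
        mul_le_mul hδ (hP.norm_sum_smul_le z) (norm_nonneg _) zero_le_one
    _ < 1 := by rw [one_mul]; exact mem_polydisc_iff.1 hz

theorem analyticOnNhd_transferFunction [CompleteSpace K] {P : Fin n → K →L[ℂ] K} (hP : IsProjectionFamily P)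
    (α : E →L[ℂ] F) (β : K →L[ℂ] F) (γ : E →L[ℂ] K) {δ : K →L[ℂ] K} (hδ : ‖δ‖ ≤ 1) :
    AnalyticOnNhd ℂ (transferFunction P α β γ δ) (polydisc n) := by
  intro z hz
  have hZ : AnalyticAt ℂ (fun z : Fin n → ℂ => ∑ i, z i • P i) z := by
    refine Finset.analyticAt_fun_sum _ fun i _ => ?_
    exact ((ContinuousLinearMap.proj (R := ℂ) (φ := fun _ : Fin n => ℂ) i).analyticAt z).smul
      analyticAt_const
  have hinv : AnalyticAt ℂ (fun z : Fin n → ℂ => Ring.inverse (1 - δ * ∑ i, z i • P i)) z := by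
    obtain ⟨w, hw⟩ := isUnit_one_sub_mul hP hδ hz
    have h1 : AnalyticAt ℂ (Ring.inverse : (K →L[ℂ] K) → _) (1 - δ * ∑ i, z i • P i) := by
      rw [← hw]; exact analyticAt_inverse w
    have h2 : AnalyticAt ℂ (fun z : Fin n → ℂ => 1 - δ * ∑ i, z i • P i) z :=
      analyticAt_const.sub (analyticAt_const.fun_mul hZ)
    exact AnalyticAt.fun_comp h1 h2
  have hmid := hZ.fun_mul hinv
  have hL := ((ContinuousLinearMap.compL ℂ E K F β ∘L
    (ContinuousLinearMap.compL ℂ E K K).flip γ).analyticAt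
    ((∑ i, z i • P i) * Ring.inverse (1 - δ * ∑ i, z i • P i)))
  exact analyticAt_const.add
    (AnalyticAt.fun_comp (f := fun z : Fin n → ℂ =>
      (∑ i, z i • P i) * Ring.inverse (1 - δ * ∑ i, z i • P i)) hL hmid)

/-- The power series coefficients of the transfer function. -/
noncomputable def transferCoeff (P : Fin n → K →L[ℂ] K) (α : E →L[ℂ] F) (β : K →L[ℂ] F)
    (γ : E →L[ℂ] K) (δ : K →L[ℂ] K) (k : Fin n → ℕ) : E →L[ℂ] F :=
  (if k = 0 then α else 0)
    + ∑ i, if k i = 0 then 0 else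
      (β ∘L P i) ∘L resolventCoeff (fun i => δ ∘L P i) γ (k - Pi.single i 1)

theorem prod_pow_sub_single {R : Type*} [CommMonoid R] (z : Fin n → R) {k : Fin n → ℕ} {i : Fin n}
    (hi : k i ≠ 0) : ∏ j, z j ^ k j = z i * ∏ j, z j ^ (k - Pi.single i 1 : Fin n → ℕ) j := by
  conv_lhs => rw [← sub_single_add_single hi]
  simp only [Pi.add_apply, pow_add, Finset.prod_mul_distrib]
  rw [mul_comm]
  congr 1
  rw [Finset.prod_eq_single i]
  · simp
  · intro j _ hj; simp [hj]
  · simp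

theorem hasSum_smul_shift (P : Fin n → K →L[ℂ] K) {G : (Fin n → ℕ) → E →L[ℂ] K} {X : E →L[ℂ] K}
    {z : Fin n → ℂ} (hX : HasSum (fun k : Fin n → ℕ => (∏ i, z i ^ k i) • G k) X)
    (a : E →L[ℂ] F) (B : K →L[ℂ] F) :
    HasSum (fun k : Fin n → ℕ => (∏ i, z i ^ k i) • ((if k = 0 then a else 0)
      + ∑ i, if k i = 0 then 0 else (B ∘L P i) ∘L G (k - Pi.single i 1)))
      (a + B ∘L (∑ i, z i • P i) ∘L X) := by
  have h := hasSum_shift_sum hX a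
    fun i => z i • ContinuousLinearMap.compL ℂ E K F (B ∘L P i)
  convert! h using 1
  · funext k
    rw [smul_add, Finset.smul_sum]
    congr 1
    · split_ifs with hk
      · subst hk; simp
      · simp
    · refine Finset.sum_congr rfl fun i _ => ?_
      split_ifs with hi
      · simp
      · rw [prod_pow_sub_single z hi]
        simp only [smul_apply, ContinuousLinearMap.compL_apply,
          ContinuousLinearMap.comp_smul, smul_smul]
  · congr 1
    ext x
    simp

/-- With `X = ∑ φ k` and `Z = ∑ i, Z i`, the recursions give `X = g + d Z X` and `S = a + b Z X`.
The block inequality at `h = Z X x` reads `‖S x‖² + ‖X x‖² ≤ ‖x‖² + ‖Z X x‖²`, and `‖Z X x‖ ≤ ‖X x‖`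
cancels the state terms. -/
theorem exists_hasSum_contraction {V₁ V₂ V₃ : Type*} [NormedAddCommGroup V₁] [NormedSpace ℂ V₁]
    [NormedAddCommGroup V₂] [NormedSpace ℂ V₂] [CompleteSpace V₂] [NormedAddCommGroup V₃]
    [NormedSpace ℂ V₃] (a : V₁ →L[ℂ] V₃) (b : V₂ →L[ℂ] V₃) (g : V₁ →L[ℂ] V₂) (d : V₂ →L[ℂ] V₂)
    (Z : Fin n → V₂ →L[ℂ] V₂) (φ : (Fin n → ℕ) → V₁ →L[ℂ] V₂) (ψ : (Fin n → ℕ) → V₁ →L[ℂ] V₃)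
    (r : (Fin n → ℕ) → ℝ) (hr : Summable r) (hφr : ∀ k, ‖φ k‖ ≤ r k)
    (hφ : ∀ k, φ k = (if k = 0 then g else 0)
      + ∑ i, if k i = 0 then 0 else (d ∘L Z i) ∘L φ (k - Pi.single i 1))
    (hψ : ∀ k, ψ k = (if k = 0 then a else 0)
      + ∑ i, if k i = 0 then 0 else (b ∘L Z i) ∘L φ (k - Pi.single i 1))
    (hZ : ∀ y, ‖∑ i, Z i y‖ ≤ ‖y‖)
    (hblock : ∀ x h, ‖a x + b h‖ ^ 2 + ‖g x + d h‖ ^ 2 ≤ ‖x‖ ^ 2 + ‖h‖ ^ 2) :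
    ∃ S : V₁ →L[ℂ] V₃, HasSum ψ S ∧ ‖S‖ ≤ 1 := by
  obtain ⟨X, hX⟩ := Summable.of_norm_bounded hr hφr
  have h1 : X = g + ∑ i, (d ∘L Z i) ∘L X := by
    refine hX.unique ?_
    convert! hasSum_shift_sum hX g fun i => ContinuousLinearMap.compL ℂ V₁ V₂ V₂ (d ∘L Z i) using 1
    funext k
    exact hφ k
  have h2 : HasSum ψ (a + ∑ i, (b ∘L Z i) ∘L X) := by
    convert! hasSum_shift_sum hX a fun i => ContinuousLinearMap.compL ℂ V₁ V₂ V₃ (b ∘L Z i) using 1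
    funext k
    exact hψ k
  refine ⟨_, h2, ContinuousLinearMap.opNorm_le_bound _ zero_le_one fun x => ?_⟩
  have h3 : X x = g x + d (∑ i, Z i (X x)) := by
    conv_lhs => rw [h1]
    simp
  have h4 : (a + ∑ i, (b ∘L Z i) ∘L X) x = a x + b (∑ i, Z i (X x)) := by simp
  have h5 := hblock x (∑ i, Z i (X x))
  rw [← h3] at h5
  have h6 := pow_le_pow_left₀ (norm_nonneg _) (hZ (X x)) 2
  rw [one_mul, h4]
  exact le_of_sq_le_sq (by linarith) (norm_nonneg _)

/-- How a shifted power series is tensored with monomials of commuting operators. -/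
theorem tensorOp_shift {H : Type*} [NormedAddCommGroup H] [InnerProductSpace ℂ H]
    {T : Fin n → (H →L[ℂ] H)} (hT : ∀ i j, Commute (T i) (T j)) (P : Fin n → K →L[ℂ] K)
    (G : (Fin n → ℕ) → E →L[ℂ] K) (a : E →L[ℂ] F) (B : K →L[ℂ] F) (k : Fin n → ℕ) :
    tensorOp ((if k = 0 then a else 0)
      + ∑ i, if k i = 0 then 0 else (B ∘L P i) ∘L G (k - Pi.single i 1)) (monomialOp T k)
      = (if k = 0 then tensorOp a (ContinuousLinearMap.id ℂ H) else 0)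
      + ∑ i, if k i = 0 then 0 else (tensorOp B (ContinuousLinearMap.id ℂ H) ∘L
        tensorOp (P i) (T i)) ∘L tensorOp (G (k - Pi.single i 1))
          (monomialOp T (k - Pi.single i 1)) := by
  rw [tensorOp_add_left, tensorOp_sum_left]
  congr 1
  · split_ifs with hk
    · subst hk; rw [monomialOp_zero]; rfl
    · rw [tensorOp_zero_left]
  · refine Finset.sum_congr rfl fun i _ => ?_
    split_ifs with hi
    · rw [tensorOp_zero_left]
    · rw [tensorOp_comp, tensorOp_comp]
      conv_lhs => rw [← sub_single_add_single hi, monomialOp_add_single T hT]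
      simp only [add_tsub_cancel_right]
      rfl

/-- The sum `X` of the resolvent series satisfies `(1 - δ Z(z)) X = γ`, and the factor is invertible
on the polydisc. -/
theorem hasSum_transferFunction [CompleteSpace K] {P : Fin n → K →L[ℂ] K}
    (hP : IsProjectionFamily P)
    (α : E →L[ℂ] F) (β : K →L[ℂ] F) {γ : E →L[ℂ] K} {δ : K →L[ℂ] K} (hγ : ‖γ‖ ≤ 1) (hδ : ‖δ‖ ≤ 1)
    {z : Fin n → ℂ} (hz : z ∈ polydisc n) :
    HasSum (fun k => (∏ i, z i ^ k i) • transferCoeff P α β γ δ k)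
      (transferFunction P α β γ δ z) := by
  set G := resolventCoeff (fun i => δ ∘L P i) γ with hG
  have hsum : Summable fun k : Fin n → ℕ => (∏ i, z i ^ k i) • G k := by
    refine Summable.of_norm_bounded (summable_prod_pow (fun i => ‖z i‖) (fun i => norm_nonneg _) hz)
      fun k => ?_
    rw [norm_smul, norm_prod]
    simp only [norm_pow]
    exact mul_le_of_le_one_right (by positivity) (norm_resolventCoeff_le hP hδ hγ k)
  obtain ⟨X, hX⟩ := hsum
  have hXeq : X = γ + δ ∘L (∑ i, z i • P i) ∘L X := by
    refine hX.unique ?_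
    convert! hasSum_smul_shift P hX γ δ using 1
    funext k
    congr 1
    rw [hG]
    exact resolventCoeff_eq _ _ _
  have hXinv : X = Ring.inverse (1 - δ * ∑ i, z i • P i) ∘L γ := by
    have hu := isUnit_one_sub_mul hP hδ hz
    have h1 : (1 - δ * ∑ i, z i • P i) ∘L X = γ := by
      rw [ContinuousLinearMap.sub_comp, sub_eq_iff_eq_add]
      exact hXeq
    rw [← h1, ← ContinuousLinearMap.comp_assoc]
    have := Ring.inverse_mul_cancel _ hu
    change X = (Ring.inverse (1 - δ * ∑ i, z i • P i) * (1 - δ * ∑ i, z i • P i)) ∘L X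
    rw [this]
    rfl
  have := hasSum_smul_shift P hX α β
  rw [hXinv] at this
  exact this

set_option maxHeartbeats 2000000 in
/-- Transfer functions of contractive colligations are Schur–Agler functions. -/
theorem isSchurAgler_transferFunction {E F K : Type u} [NormedAddCommGroup E]
    [InnerProductSpace ℂ E] [CompleteSpace E] [NormedAddCommGroup F] [InnerProductSpace ℂ F]
    [CompleteSpace F] [NormedAddCommGroup K] [InnerProductSpace ℂ K] [CompleteSpace K]
    {P : Fin n → K →L[ℂ] K} (hP : IsProjectionFamily P)
    (U : WithLp 2 (E × K) →L[ℂ] WithLp 2 (F × K)) (hU : ‖U‖ ≤ 1) :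
    IsSchurAgler (transferFunction P (WithLp.fstL 2 ℂ F K ∘L U ∘L prodInl E K)
      (WithLp.fstL 2 ℂ F K ∘L U ∘L prodInr E K) (WithLp.sndL 2 ℂ F K ∘L U ∘L prodInl E K)
      (WithLp.sndL 2 ℂ F K ∘L U ∘L prodInr E K)) := by
  set α := WithLp.fstL 2 ℂ F K ∘L U ∘L prodInl E K with hα
  set β := WithLp.fstL 2 ℂ F K ∘L U ∘L prodInr E K with hβ
  set γ := WithLp.sndL 2 ℂ F K ∘L U ∘L prodInl E K with hγ
  set δ := WithLp.sndL 2 ℂ F K ∘L U ∘L prodInr E K with hδ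
  have hU' : ∀ p, ‖(U p).snd‖ ≤ ‖p‖ := fun p =>
    (WithLp.norm_snd_le F (U p)).trans ((U.le_of_opNorm_le hU p).trans_eq (one_mul _))
  have hγ1 : ‖γ‖ ≤ 1 := ContinuousLinearMap.opNorm_le_bound _ zero_le_one fun x => by
    rw [one_mul]
    exact (hU' (prodInl E K x)).trans_eq (by rw [prodInl_apply]; simp)
  have hδ1 : ‖δ‖ ≤ 1 := ContinuousLinearMap.opNorm_le_bound _ zero_le_one fun x => by
    rw [one_mul]
    exact (hU' (prodInr E K x)).trans_eq (by rw [prodInr_apply]; simp)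
  refine ⟨analyticOnNhd_transferFunction hP α β γ hδ1, transferCoeff P α β γ δ,
    fun z hz => hasSum_transferFunction hP α β hγ1 hδ1 hz, ?_⟩
  intro H _ _ _ T hT hT1
  refine exists_hasSum_contraction (tensorOp α (ContinuousLinearMap.id ℂ H))
    (tensorOp β (ContinuousLinearMap.id ℂ H)) (tensorOp γ (ContinuousLinearMap.id ℂ H))
    (tensorOp δ (ContinuousLinearMap.id ℂ H)) (fun i => tensorOp (P i) (T i))
    (fun k => tensorOp (resolventCoeff (fun i => δ ∘L P i) γ k) (monomialOp T k)) _ _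
    (summable_prod_pow (fun i => ‖T i‖) (fun i => norm_nonneg _) hT1) (fun k => ?_) (fun k => ?_)
    (fun k => tensorOp_shift hT P _ α β k) (norm_sum_tensorOp_le hP T fun i => (hT1 i).le)
    (norm_sq_tensorOp_blocks_le U hU)
  · refine (norm_tensorOp_le _ _).trans ?_
    refine (mul_le_of_le_one_left (norm_nonneg _) (norm_resolventCoeff_le hP hδ1 hγ1 k)).trans ?_
    exact norm_monomialOp_le T k
  · rw [← tensorOp_shift hT P _ γ δ k, ← resolventCoeff_eq]

end SchurAgler

/-! ### Realization of a decomposition by a contractive colligation -/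

section Realization

theorem norm_linearCombination_eq {J F G : Type*} [NormedAddCommGroup F] [InnerProductSpace ℂ F]
    [NormedAddCommGroup G] [InnerProductSpace ℂ G] (f : J → F) (g : J → G)
    (h : ∀ j k, inner ℂ (g j) (g k) = inner ℂ (f j) (f k)) (c : J →₀ ℂ) :
    ‖Finsupp.linearCombination ℂ g c‖ = ‖Finsupp.linearCombination ℂ f c‖ := by
  have key : inner ℂ (Finsupp.linearCombination ℂ g c) (Finsupp.linearCombination ℂ g c)
      = inner ℂ (Finsupp.linearCombination ℂ f c) (Finsupp.linearCombination ℂ f c) := by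
    simp only [Finsupp.linearCombination_apply, Finsupp.sum, sum_inner, inner_sum,
      inner_smul_left, inner_smul_right, h]
  rw [norm_eq_sqrt_re_inner (𝕜 := ℂ), key, ← norm_eq_sqrt_re_inner]

variable {n : ℕ}

/-- The coordinate projections of a finite Hilbert space direct sum. -/
noncomputable def coordProj (G : Fin n → Type*) [∀ i, NormedAddCommGroup (G i)]
    [∀ i, InnerProductSpace ℂ (G i)] (i : Fin n) : PiLp 2 G →L[ℂ] PiLp 2 G :=
  (PiLp.continuousLinearEquiv 2 ℂ G).symm.toContinuousLinearMap
    ∘L ContinuousLinearMap.single ℂ G i ∘L PiLp.proj 2 G i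

theorem coordProj_apply (G : Fin n → Type*) [∀ i, NormedAddCommGroup (G i)]
    [∀ i, InnerProductSpace ℂ (G i)] (i j : Fin n) (x : PiLp 2 G) :
    coordProj G i x j = if j = i then x j else 0 := by
  have : coordProj G i x j = (Pi.single i (x i) : ∀ i, G i) j := rfl
  rw [this]
  split_ifs with h
  · subst h; simp
  · simp [h]

theorem isProjectionFamily_coordProj (G : Fin n → Type*) [∀ i, NormedAddCommGroup (G i)]
    [∀ i, InnerProductSpace ℂ (G i)] [∀ i, CompleteSpace (G i)] :
    IsProjectionFamily (coordProj G) where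
  adjoint_eq i := by
    refine ((ContinuousLinearMap.eq_adjoint_iff _ _).2 fun x y => ?_).symm
    simp only [PiLp.inner_apply, coordProj_apply]
    refine Finset.sum_congr rfl fun j _ => ?_
    split_ifs <;> simp
  comp_self i := by
    ext x j
    simp only [ContinuousLinearMap.comp_apply, coordProj_apply]
    split_ifs <;> rfl
  comp_ne i j hij := by
    ext x k
    simp only [ContinuousLinearMap.comp_apply, coordProj_apply]
    split_ifs with h1 h2
    · exact absurd (h1.symm.trans h2) hij
    · rfl
    · rfl
  sum_eq := by
    ext x j
    simp [sum_apply, WithLp.ofLp_sum, Finset.sum_apply, coordProj_apply]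

theorem exists_isSchurAgler_of_decomposition {E F : Type u} [NormedAddCommGroup E]
    [InnerProductSpace ℂ E] [CompleteSpace E] [NormedAddCommGroup F] [InnerProductSpace ℂ F]
    [CompleteSpace F] (G : Fin n → Type u) [∀ i, NormedAddCommGroup (G i)]
    [∀ i, InnerProductSpace ℂ (G i)] [∀ i, CompleteSpace (G i)]
    (B : polydisc n → F →L[ℂ] E) (A : ∀ i, polydisc n → F →L[ℂ] G i)
    (h : ∀ (z w : polydisc n) (η ξ : F), inner ℂ η ξ - inner ℂ (B z η) (B w ξ)
      = ∑ i, (1 - z.1 i * conj (w.1 i)) * inner ℂ (A i z η) (A i w ξ)) :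
    ∃ Θ : (Fin n → ℂ) → (E →L[ℂ] F), IsSchurAgler Θ ∧
      ∀ z : polydisc n, Θ z.1 = (B z).adjoint := by
  -- Moving the negative terms of `h` across makes the Gram matrices of `f` and `g` equal.
  let f : polydisc n × F → WithLp 2 (F × PiLp 2 G) := fun p =>
    WithLp.toLp 2 (p.2, WithLp.toLp 2 fun i => conj (p.1.1 i) • A i p.1 p.2)
  let g : polydisc n × F → WithLp 2 (E × PiLp 2 G) := fun p =>
    WithLp.toLp 2 (B p.1 p.2, WithLp.toLp 2 fun i => A i p.1 p.2)
  have hgram : ∀ p q, inner ℂ (g p) (g q) = inner ℂ (f p) (f q) := by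
    rintro ⟨z, η⟩ ⟨w, ξ⟩
    have := h z w η ξ
    simp only [sub_mul, one_mul, Finset.sum_sub_distrib] at this
    have e : ∀ i, conj (w.1 i) * z.1 i * inner ℂ (A i z η) (A i w ξ)
        = z.1 i * conj (w.1 i) * inner ℂ (A i z η) (A i w ξ) := fun i => by ring
    simp only [f, g, WithLp.prod_inner_apply, PiLp.inner_apply, inner_smul_left,
      inner_smul_right, Complex.conj_conj, ← mul_assoc, e]
    linear_combination (-1 : ℂ) * this
  obtain ⟨V, hV1, hV, -⟩ := exists_contraction_extend f g fun c =>
    (norm_linearCombination_eq f g hgram c).le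
  have hU : ‖V.adjoint‖ ≤ 1 := by rwa [LinearIsometryEquiv.norm_map]
  refine ⟨_, isSchurAgler_transferFunction (isProjectionFamily_coordProj G) V.adjoint hU, ?_⟩
  intro z
  have hδ : ‖WithLp.sndL 2 ℂ F (PiLp 2 G) ∘L V.adjoint ∘L prodInr E (PiLp 2 G)‖ ≤ 1 :=
    ContinuousLinearMap.opNorm_le_bound _ zero_le_one fun x => by
      rw [one_mul]
      refine (WithLp.norm_snd_le F (V.adjoint (prodInr E (PiLp 2 G) x))).trans ?_
      refine ((V.adjoint.le_of_opNorm_le hU _).trans_eq (one_mul _)).trans_eq ?_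
      rw [prodInr_apply]; simp
  ext ξ
  refine ext_inner_left ℂ fun η => ?_
  rw [ContinuousLinearMap.adjoint_inner_right]
  set δ := WithLp.sndL 2 ℂ F (PiLp 2 G) ∘L V.adjoint ∘L prodInr E (PiLp 2 G) with hδdef
  set γ := WithLp.sndL 2 ℂ F (PiLp 2 G) ∘L V.adjoint ∘L prodInl E (PiLp 2 G) with hγdef
  set Z := ∑ i, z.1 i • coordProj G i with hZ
  set x : PiLp 2 G := Ring.inverse (1 - δ * Z) (γ ξ) with hx
  have hx1 : x - δ (Z x) = γ ξ := by
    have := Ring.mul_inverse_cancel _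
      (isUnit_one_sub_mul (isProjectionFamily_coordProj G) hδ z.2)
    exact congrArg (fun T => T (γ ξ)) this
  -- With input `ξ` and state `Z x`, the colligation `V^*` returns the output `Θ(z) ξ` and the state
  -- `x`.
  set p : WithLp 2 (E × PiLp 2 G) := WithLp.toLp 2 (ξ, Z x) with hp
  have hp1 : p = prodInl E (PiLp 2 G) ξ + prodInr E (PiLp 2 G) (Z x) := by
    rw [prodInl_apply, prodInr_apply, ← WithLp.toLp_add, Prod.mk_add_mk, add_zero, zero_add]
  have hsnd : (V.adjoint p).snd = x := by
    have : (V.adjoint p).snd = γ ξ + δ (Z x) := by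
      rw [hp1, map_add]; rfl
    rw [this, ← hx1]; abel
  have hfst : (V.adjoint p).fst = transferFunction (coordProj G)
      (WithLp.fstL 2 ℂ F (PiLp 2 G) ∘L V.adjoint ∘L prodInl E (PiLp 2 G))
      (WithLp.fstL 2 ℂ F (PiLp 2 G) ∘L V.adjoint ∘L prodInr E (PiLp 2 G)) γ δ z.1 ξ := by
    rw [hp1, map_add]; rfl
  -- Since `V f = g`, pairing with `f (z, η)` becomes pairing with `g (z, η)`; the state terms on
  -- the two sides coincide, leaving `⟨η, Θ(z) ξ⟩ = ⟨B(z) η, ξ⟩`.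
  have hkey : inner ℂ (f (z, η)) (V.adjoint p) = inner ℂ (g (z, η)) p := by
    rw [ContinuousLinearMap.adjoint_inner_right, hV]
  rw [WithLp.prod_inner_apply, WithLp.prod_inner_apply] at hkey
  have hfst' : (V.adjoint p).ofLp.1 = (V.adjoint p).fst := rfl
  have hsnd' : (V.adjoint p).ofLp.2 = (V.adjoint p).snd := rfl
  rw [hfst', hsnd', hsnd, hfst] at hkey
  have hZx : ∀ i, (Z x) i = z.1 i • x i := by
    intro i
    rw [hZ]
    simp [coordProj_apply]
  simp only [f, g, hp, PiLp.inner_apply, hZx, inner_smul_left, inner_smul_right,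
    Complex.conj_conj] at hkey
  exact add_right_cancel hkey

theorem one_sub_mul_conj_ne_zero (z w : polydisc n) (i : Fin n) :
    1 - z.1 i * conj (w.1 i) ≠ 0 := by
  intro h
  have h1 : ‖z.1 i * conj (w.1 i)‖ < 1 := by
    rw [norm_mul, RCLike.norm_conj]
    exact mul_lt_one_of_nonneg_of_lt_one_left (norm_nonneg _) (z.2 i) (w.2 i).le
  rw [← sub_eq_zero.1 h, norm_one] at h1
  exact lt_irrefl _ h1

theorem szegoKernel_inv (z w : polydisc n) :
    (szegoKernel z w)⁻¹ = ∏ i, (1 - z.1 i * conj (w.1 i)) := by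
  simp [szegoKernel]

theorem szegoKernel_ne_zero (z w : polydisc n) : szegoKernel z w ≠ 0 := by
  refine fun h => inv_ne_zero (a := (szegoKernel z w)⁻¹) ?_ (by rw [inv_inv, h])
  rw [szegoKernel_inv]
  exact Finset.prod_ne_zero_iff.2 fun i _ => one_sub_mul_conj_ne_zero z w i

/-- Converts between the decomposition of `K` in condition 1 and the Agler decomposition of `𝕊ₙ⁻¹
K`. -/
theorem szegoKernel_inv_mul (z w : polydisc n) (i : Fin n) :
    (szegoKernel z w)⁻¹ * (1 / ∏ j ∈ Finset.univ.erase i, (1 - z.1 j * conj (w.1 j)))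
      = 1 - z.1 i * conj (w.1 i) := by
  rw [szegoKernel_inv, ← Finset.mul_prod_erase _ _ (Finset.mem_univ i), mul_one_div,
    mul_div_assoc, div_self, mul_one]
  exact Finset.prod_ne_zero_iff.2 fun j _ => one_sub_mul_conj_ne_zero z w j

theorem exists_isSchurAgler_of_kernels {F : Type u} [NormedAddCommGroup F]
    [InnerProductSpace ℂ F] [CompleteSpace F] (K : polydisc n → polydisc n → (F →L[ℂ] F))
    (L : Fin n → polydisc n → polydisc n → (F →L[ℂ] F)) (hL : ∀ i, IsPosKernel (L i))
    (hKL : ∀ z w : polydisc n, K z w =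
      ∑ i, (1 / ∏ j ∈ Finset.univ.erase i, (1 - z.1 j * conj (w.1 j))) • L i z w)
    (hK : IsPosKernel fun z w : polydisc n =>
      ContinuousLinearMap.id ℂ F - (szegoKernel z w)⁻¹ • K z w) :
    ∃ (E : Type u) (_ : NormedAddCommGroup E) (_ : InnerProductSpace ℂ E) (_ : CompleteSpace E)
      (Θ : (Fin n → ℂ) → (E →L[ℂ] F)),
      IsSchurAgler Θ ∧ ∀ z w : polydisc n, K z w = deBrangesRovnyakKernel Θ z w := by
  obtain ⟨E, _, _, _, B, hB⟩ := hK.exists_factor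
  choose G i1 i2 i3 A hA using fun i => (hL i).exists_factor
  have hdec : ∀ z w : polydisc n, (szegoKernel z w)⁻¹ • K z w
      = ∑ i, (1 - z.1 i * conj (w.1 i)) • L i z w := by
    intro z w
    rw [hKL, Finset.smul_sum]
    refine Finset.sum_congr rfl fun i _ => ?_
    rw [smul_smul, szegoKernel_inv_mul]
  obtain ⟨Θ, hΘ, hΘB⟩ := exists_isSchurAgler_of_decomposition G B A fun z w η ξ => by
    have h1 := congrArg (fun T => inner ℂ η (T ξ)) (hB z w)
    simp only [hdec, hA] at h1
    simp only [sub_apply, ContinuousLinearMap.id_apply, sum_apply, smul_apply, inner_sub_right,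
      inner_sum, inner_smul_right, ContinuousLinearMap.comp_apply,
      ContinuousLinearMap.adjoint_inner_right] at h1
    rw [← h1]; ring
  refine ⟨E, ‹_›, ‹_›, ‹_›, Θ, hΘ, fun z w => ?_⟩
  rw [deBrangesRovnyakKernel, hΘB, hΘB, ContinuousLinearMap.adjoint_adjoint, ← hB z w,
    sub_sub_cancel, smul_smul, mul_inv_cancel₀ (szegoKernel_ne_zero z w), one_smul]

end Realization

/-! ### The Schur–Agler inequality on Gram vectors -/

section GramInequality

theorem hasSum_inner_apply {κ V₁ V₂ : Type*} [NormedAddCommGroup V₁] [NormedSpace ℂ V₁]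
    [NormedAddCommGroup V₂] [InnerProductSpace ℂ V₂] {φ : κ → V₁ →L[ℂ] V₂} {S : V₁ →L[ℂ] V₂}
    (h : HasSum φ S) (x : V₁) (y : V₂) :
    HasSum (fun k => inner ℂ y (φ k x)) (inner ℂ y (S x)) :=
  (innerSL ℂ y ∘L ContinuousLinearMap.apply ℂ V₂ x).hasSum h

variable {n : ℕ} {E F H : Type u} [NormedAddCommGroup E] [InnerProductSpace ℂ E]
  [NormedAddCommGroup F] [InnerProductSpace ℂ F] [NormedAddCommGroup H] [InnerProductSpace ℂ H]

theorem HilbertTensor.inner_tmul (x x' : E) (y y' : H) :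
    inner ℂ ((x ⊗ₜ[ℂ] y : E ⊗[ℂ] H) : HilbertTensor E H) ((x' ⊗ₜ[ℂ] y' : E ⊗[ℂ] H) :
      HilbertTensor E H) = inner ℂ x x' * inner ℂ y y' := by
  rw [UniformSpace.Completion.inner_coe, TensorProduct.inner_tmul]

theorem norm_sq_sum_tmul {ι : Type*} [Fintype ι] (η : ι → E) (f : ι → H) :
    ‖∑ a, ((η a ⊗ₜ[ℂ] f a : E ⊗[ℂ] H) : HilbertTensor E H)‖ ^ 2
      = (∑ a, ∑ b, inner ℂ (η a) (η b) * inner ℂ (f a) (f b)).re := by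
  rw [← inner_self_eq_norm_sq (𝕜 := ℂ), sum_inner]
  simp only [inner_sum, HilbertTensor.inner_tmul]
  rfl

variable [CompleteSpace E] [CompleteSpace F] [CompleteSpace H]

/-- Each `f a` is a joint eigenvector of the adjoints of the `T i`, so `Θ(T)^*` maps `η a ⊗ f a` to
`Θ(μ a)^* (η a) ⊗ f a`. The inequality says that `Θ(T)^*` is contractive on the sum of these
tensors. -/
theorem IsSchurAgler.re_sum_le_of_eigenvectors {Θ : (Fin n → ℂ) → (E →L[ℂ] F)}
    (hΘ : IsSchurAgler Θ) {ι : Type*} [Fintype ι] (T : Fin n → (H →L[ℂ] H))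
    (hT : ∀ i j, Commute (T i) (T j)) (hT1 : ∀ i, ‖T i‖ < 1) (μ : ι → Fin n → ℂ)
    (hμ : ∀ a, μ a ∈ polydisc n) (f : ι → H)
    (hf : ∀ a i h, inner ℂ (f a) (T i h) = μ a i * inner ℂ (f a) h) (η : ι → F) :
    (∑ a, ∑ b, inner ℂ ((Θ (μ a)).adjoint (η a)) ((Θ (μ b)).adjoint (η b))
        * inner ℂ (f a) (f b)).re
      ≤ (∑ a, ∑ b, inner ℂ (η a) (η b) * inner ℂ (f a) (f b)).re := by
  obtain ⟨c, hc, hvN⟩ := hΘ.vonNeumann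
  obtain ⟨S, hS, hS1⟩ := hvN H T hT hT1
  rw [← norm_sq_sum_tmul, ← norm_sq_sum_tmul]
  have hSab : ∀ a (ξ : E) (h : H), inner ℂ ((η a ⊗ₜ[ℂ] f a : F ⊗[ℂ] H) : HilbertTensor F H)
      (S ((ξ ⊗ₜ[ℂ] h : E ⊗[ℂ] H) : HilbertTensor E H))
      = inner ℂ ((Θ (μ a)).adjoint (η a)) ξ * inner ℂ (f a) h := by
    intro a ξ h
    refine (hasSum_inner_apply hS _ _).unique ?_
    rw [ContinuousLinearMap.adjoint_inner_left]
    convert! (hasSum_inner_apply (hc (μ a) (hμ a)) ξ (η a)).mul_right (inner ℂ (f a) h) using 1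
    funext k
    rw [tensorOp_coe, TensorProduct.mapL_tmul, HilbertTensor.inner_tmul,
      inner_monomialOp T k (μ a) (f a) (hf a), smul_apply, inner_smul_right]
    ring
  set v := ∑ a, (((Θ (μ a)).adjoint (η a) ⊗ₜ[ℂ] f a : E ⊗[ℂ] H) : HilbertTensor E H) with hv
  set w := ∑ a, ((η a ⊗ₜ[ℂ] f a : F ⊗[ℂ] H) : HilbertTensor F H) with hw
  have h1 : inner ℂ w (S v) = ((‖v‖ ^ 2 : ℝ) : ℂ) := by
    have h2 : ((‖v‖ ^ 2 : ℝ) : ℂ) = inner ℂ v v := by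
      rw [inner_self_eq_norm_sq_to_K]; norm_cast
    rw [h2, hw, hv, map_sum, sum_inner, sum_inner]
    simp only [inner_sum, hSab, HilbertTensor.inner_tmul]
  -- `v` plays the role of `S^* w`: here `⟨w, S v⟩ = ‖v‖²`.
  have h3 : ‖v‖ ^ 2 ≤ ‖w‖ * ‖v‖ := by
    have h4 : ‖inner ℂ w (S v)‖ ≤ ‖w‖ * ‖v‖ :=
      (norm_inner_le_norm _ _).trans (mul_le_mul_of_nonneg_left
        ((S.le_of_opNorm_le hS1 v).trans_eq (one_mul _)) (norm_nonneg _))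
    rwa [h1, Complex.norm_real, Real.norm_of_nonneg (sq_nonneg _)] at h4
  refine pow_le_pow_left₀ (norm_nonneg _) ?_ 2
  by_contra! hlt
  have hpos : 0 < ‖v‖ := (norm_nonneg _).trans_lt hlt
  nlinarith

/-- On the span of the `f b` the operators are simultaneously diagonal, and all vanish on its
orthogonal complement, so they commute everywhere. Finite dimension of the span ensures that the two
subspaces fill `H`. -/
theorem exists_commuting_extend {ι : Type*} [Fintype ι] (f : ι → H) (x : ι → Fin n → ℂ)
    (h : ∀ i (c : ι → ℂ), ‖∑ b, c b • conj (x b i) • f b‖ ≤ ‖∑ b, c b • f b‖) :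
    ∃ R : Fin n → (H →L[ℂ] H), (∀ i j, Commute (R i) (R j)) ∧ (∀ i, ‖R i‖ ≤ 1) ∧
      ∀ i b, R i (f b) = conj (x b i) • f b := by
  have hex : ∀ i, ∃ R : H →L[ℂ] H, ‖R‖ ≤ 1 ∧ (∀ b, R (f b) = conj (x b i) • f b) ∧
      ∀ y, (∀ b, inner ℂ (f b) y = 0) → R y = 0 := fun i =>
    exists_contraction_extend f (fun b => conj (x b i) • f b) fun c => by
      simpa [Finsupp.linearCombination_apply, Finsupp.sum_fintype] using h i c
  choose R hR1 hRf hR0 using hex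
  refine ⟨R, fun i j => ?_, hR1, hRf⟩
  let M : Submodule ℂ H := Submodule.span ℂ (Set.range f)
  have : FiniteDimensional ℂ M := FiniteDimensional.span_of_finite ℂ (Set.finite_range f)
  have hle : M ⊔ Mᗮ ≤ LinearMap.ker (R i * R j - R j * R i : H →L[ℂ] H).toLinearMap := by
    refine sup_le (Submodule.span_le.2 ?_) fun y hy => ?_
    · rintro _ ⟨b, rfl⟩
      simp [hRf, smul_smul, mul_comm]
    · have hy' : ∀ b, inner ℂ (f b) y = 0 := fun b =>
        (Submodule.mem_orthogonal _ _).1 hy _ (Submodule.subset_span ⟨b, rfl⟩)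
      simp [hR0 _ y hy']
  rw [Submodule.sup_orthogonal_of_hasOrthogonalProjection] at hle
  have h0 : R i * R j - R j * R i = 0 := by
    ext y
    exact hle (Submodule.mem_top (x := y))
  exact sub_eq_zero.1 h0

/-- The adjoints of the diagonal operators are contractions, perhaps not strict; they are scaled by
`r < 1`, which moves the nodes to `r • x a`, and `r → 1` uses continuity of `Θ`. -/
theorem IsSchurAgler.re_sum_le {Θ : (Fin n → ℂ) → (E →L[ℂ] F)} (hΘ : IsSchurAgler Θ)
    {ι : Type*} [Fintype ι] (x : ι → polydisc n) (f : ι → H)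
    (h : ∀ i (c : ι → ℂ), ‖∑ b, c b • conj ((x b).1 i) • f b‖ ≤ ‖∑ b, c b • f b‖) (η : ι → F) :
    (∑ a, ∑ b, inner ℂ ((Θ (x a).1).adjoint (η a)) ((Θ (x b).1).adjoint (η b))
        * inner ℂ (f a) (f b)).re
      ≤ (∑ a, ∑ b, inner ℂ (η a) (η b) * inner ℂ (f a) (f b)).re := by
  obtain ⟨R, hRc, hR1, hRf⟩ := exists_commuting_extend f (fun a => (x a).1) h
  have hr : ∀ r : ℝ, r ∈ Set.Ioo (0 : ℝ) 1 →
      (∑ a, ∑ b, inner ℂ ((Θ ((r : ℂ) • (x a).1)).adjoint (η a))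
        ((Θ ((r : ℂ) • (x b).1)).adjoint (η b)) * inner ℂ (f a) (f b)).re
      ≤ (∑ a, ∑ b, inner ℂ (η a) (η b) * inner ℂ (f a) (f b)).re := by
    rintro r ⟨h0, h1⟩
    have hrn : ‖(r : ℂ)‖ = r := by rw [Complex.norm_real, Real.norm_of_nonneg h0.le]
    refine hΘ.re_sum_le_of_eigenvectors (fun i => (r : ℂ) • (R i).adjoint) (fun i j => ?_)
      (fun i => ?_) (fun a => (r : ℂ) • (x a).1) (fun a => ?_) f (fun a i y => ?_) η
    · refine (Commute.smul_left ?_ _).smul_right _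
      change (R i).adjoint * (R j).adjoint = (R j).adjoint * (R i).adjoint
      rw [← ContinuousLinearMap.star_eq_adjoint, ← ContinuousLinearMap.star_eq_adjoint, ← star_mul,
        ← star_mul, (hRc i j).eq]
    · rw [norm_smul, hrn, LinearIsometryEquiv.norm_map]
      exact (mul_le_of_le_one_right h0.le (hR1 i)).trans_lt h1
    · rw [mem_polydisc_iff, norm_smul, hrn]
      exact (mul_le_of_le_one_right h0.le (mem_polydisc_iff.1 (x a).2).le).trans_lt h1
    · rw [smul_apply, inner_smul_right, ContinuousLinearMap.adjoint_inner_right, hRf,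
        inner_smul_left, Complex.conj_conj, Pi.smul_apply, smul_eq_mul, mul_assoc]
  have hcont : ∀ a, Filter.Tendsto (fun r : ℝ => (Θ ((r : ℂ) • (x a).1)).adjoint (η a))
      (nhdsWithin 1 (Set.Iio 1)) (nhds ((Θ (x a).1).adjoint (η a))) := by
    intro a
    have h1 : Filter.Tendsto (fun r : ℝ => (r : ℂ) • (x a).1) (nhdsWithin 1 (Set.Iio 1))
        (nhds (x a).1) := by
      have : Continuous fun r : ℝ => (r : ℂ) • (x a).1 := by fun_prop
      have := this.tendsto 1
      simp only [Complex.ofReal_one, one_smul] at this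
      exact this.mono_left nhdsWithin_le_nhds
    have h2 := (hΘ.analytic _ (x a).2).continuousAt.tendsto.comp h1
    have h3 : Continuous fun T : E →L[ℂ] F => T.adjoint (η a) :=
      (ContinuousLinearMap.apply ℂ E (η a)).continuous.comp
        (LinearIsometryEquiv.continuous ContinuousLinearMap.adjoint)
    exact (h3.tendsto _).comp h2
  refine le_of_tendsto (x := nhdsWithin (1 : ℝ) (Set.Iio 1))
    (Complex.continuous_re.continuousAt.tendsto.comp
    (tendsto_finsetSum _ fun a _ => tendsto_finsetSum _ fun b _ =>
      ((hcont a).inner (hcont b)).mul_const _)) ?_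
  filter_upwards [Ioo_mem_nhdsLT (zero_lt_one' ℝ)] with r hr'
  exact hr r hr'

end GramInequality

/-! ### The cone of decomposable matrices -/

section Cone

/-- Repeated points may be merged by adding their weights. -/
theorem isPosScalar_of_fintype {ι : Type*} [Fintype ι] {l : ι → ι → ℂ}
    (h : ∀ w : ι → ℂ, 0 ≤ ∑ a, ∑ b, conj (w a) * l a b * w b) : IsPosScalar l := by
  classical
  intro m y v
  refine (h fun a => ∑ i, if y i = a then v i else 0).trans_eq ?_
  simp only [map_sum, Finset.sum_mul, Finset.mul_sum]
  simp only [apply_ite conj, map_zero, ite_mul, zero_mul, mul_ite, mul_zero]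
  calc _ = ∑ a, ∑ j, ∑ i, if y i = a then conj (v i) * l a (y j) * v j else 0 := by
        refine Finset.sum_congr rfl fun a _ => ?_
        rw [Finset.sum_comm]
        refine Finset.sum_congr rfl fun j _ => ?_
        rw [Finset.sum_comm]
        refine Finset.sum_congr rfl fun i _ => ?_
        simp
    _ = ∑ j, ∑ i, conj (v i) * l (y i) (y j) * v j := by
        rw [Finset.sum_comm]
        refine Finset.sum_congr rfl fun j _ => ?_
        rw [Finset.sum_comm]
        refine Finset.sum_congr rfl fun i _ => ?_
        simp
    _ = _ := Finset.sum_comm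

theorem IsPosScalar.add {Y : Type*} {l l' : Y → Y → ℂ} (h : IsPosScalar l) (h' : IsPosScalar l') :
    IsPosScalar fun a b => l a b + l' a b := by
  intro m y v
  refine (add_nonneg (h m y v) (h' m y v)).trans_eq ?_
  simp only [← Finset.sum_add_distrib]
  exact Finset.sum_congr rfl fun i _ => Finset.sum_congr rfl fun j _ => by ring

theorem IsPosScalar.smul {Y : Type*} {l : Y → Y → ℂ} (h : IsPosScalar l) {t : ℝ} (ht : 0 ≤ t) :
    IsPosScalar fun a b => (t : ℂ) * l a b := by
  intro m y v
  refine (mul_nonneg (Complex.zero_le_real.2 ht) (h m y v)).trans_eq ?_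
  simp only [Finset.mul_sum]
  exact Finset.sum_congr rfl fun i _ => Finset.sum_congr rfl fun j _ => by ring

theorem isPosScalar_zero {Y : Type*} : IsPosScalar fun _ _ : Y => (0 : ℂ) := by
  intro m y v; simp

theorem isPosScalar_rank_one {Y : Type*} (u : Y → ℂ) : IsPosScalar fun a b => conj (u a) * u b := by
  have := isPosScalar_inner u
  simpa only [RCLike.inner_apply'] using this

theorem isPosScalar_of_tendsto {Y α : Type*} {F : Filter α} [F.NeBot] {l : α → Y → Y → ℂ}
    {l' : Y → Y → ℂ} (hl : ∀ p, IsPosScalar (l p))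
    (h : ∀ a b, Filter.Tendsto (fun p => l p a b) F (nhds (l' a b))) : IsPosScalar l' := by
  intro m y v
  refine ge_of_tendsto' (tendsto_finsetSum _ fun i _ => tendsto_finsetSum _ fun j _ =>
    ((h (y i) (y j)).const_mul (conj (v i))).mul_const (v j)) fun p => hl p m y v

/-- The Szegő kernel of the disc, compressed by a rank one kernel, is positive. -/
theorem isPosScalar_div_one_sub {Y : Type*} (x : Y → ℂ) (hx : ∀ a, ‖x a‖ < 1) (u : Y → ℂ) :
    IsPosScalar fun a b => conj (u a) * u b / (1 - x a * conj (x b)) := by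
  have hlt : ∀ a b, ‖x a * conj (x b)‖ < 1 := fun a b => by
    rw [norm_mul, RCLike.norm_conj]
    exact mul_lt_one_of_nonneg_of_lt_one_left (norm_nonneg _) (hx a) (hx b).le
  refine isPosScalar_of_tendsto (F := Filter.atTop) (l := fun (N : ℕ) a b =>
    ∑ k ∈ Finset.range N, conj (u a) * u b * (x a * conj (x b)) ^ k) (fun N => ?_) fun a b => ?_
  · induction N with
    | zero => simpa using isPosScalar_zero
    | succ N ih =>
      simp only [Finset.sum_range_succ]
      refine ih.add ?_
      convert! isPosScalar_rank_one fun a => u a * conj (x a) ^ N using 3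
      simp only [map_mul, map_pow, Complex.conj_conj]
      ring
  · rw [div_eq_mul_inv]
    exact ((hasSum_geometric_of_norm_lt_one (hlt a b)).mul_left _).tendsto_sum_nat

variable {n : ℕ}

/-- The matrices with an Agler decomposition with respect to the nodes `x`. -/
def aglerCone {Y : Type*} (x : Y → polydisc n) : Set (Y → Y → ℂ) :=
  {M | ∃ l : Fin n → Y → Y → ℂ, (∀ i, IsPosScalar (l i)) ∧
    ∀ a b, M a b = ∑ i, (1 - (x a).1 i * conj ((x b).1 i)) * l i a b}

theorem convex_aglerCone {Y : Type*} (x : Y → polydisc n) : Convex ℝ (aglerCone x) := by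
  rintro M ⟨l, hl, hM⟩ M' ⟨l', hl', hM'⟩ s t hs ht -
  refine ⟨fun i a b => (s : ℂ) * l i a b + (t : ℂ) * l' i a b,
    fun i => ((hl i).smul hs).add ((hl' i).smul ht), fun a b => ?_⟩
  simp only [Pi.add_apply, Pi.smul_apply, Complex.real_smul, hM, hM', Finset.mul_sum,
    ← Finset.sum_add_distrib]
  exact Finset.sum_congr rfl fun i _ => by ring

theorem smul_mem_aglerCone {Y : Type*} (x : Y → polydisc n) {M : Y → Y → ℂ}
    (hM : M ∈ aglerCone x) {t : ℝ} (ht : 0 ≤ t) : (fun a b => (t : ℂ) * M a b) ∈ aglerCone x := by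
  obtain ⟨l, hl, hM⟩ := hM
  refine ⟨fun i a b => (t : ℂ) * l i a b, fun i => (hl i).smul ht, fun a b => ?_⟩
  simp only [hM, Finset.mul_sum]
  exact Finset.sum_congr rfl fun i _ => by ring

theorem one_sub_mul_mem_aglerCone {Y : Type*} (x : Y → polydisc n) (i : Fin n) {l : Y → Y → ℂ}
    (hl : IsPosScalar l) :
    (fun a b => (1 - (x a).1 i * conj ((x b).1 i)) * l a b) ∈ aglerCone x := by
  refine ⟨fun j => if j = i then l else fun _ _ => 0, fun j => ?_, fun a b => ?_⟩
  · dsimp only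
    split_ifs
    · exact hl
    · exact isPosScalar_zero
  · rw [Finset.sum_eq_single i]
    · simp
    · intro j _ hj; simp [hj]
    · simp

/-- One coordinate suffices: divide by its factor `1 - x_a conj x_b`, which preserves positivity.
This needs `1 ≤ n`, and it is what makes a functional nonnegative on the cone a positive matrix. -/
theorem rank_one_mem_aglerCone {Y : Type*} (x : Y → polydisc n) (hn : 1 ≤ n) (u : Y → ℂ) :
    (fun a b => conj (u a) * u b) ∈ aglerCone x := by
  convert! one_sub_mul_mem_aglerCone x ⟨0, hn⟩
    (isPosScalar_div_one_sub (fun a => (x a).1 ⟨0, hn⟩) (fun a => (x a).2 _) u) using 3 with a b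
  rw [mul_div_cancel₀]
  exact one_sub_mul_conj_ne_zero _ _ _

theorem clm_eq_sum {ι : Type*} [Fintype ι] [DecidableEq ι] (φ : (ι → ι → ℂ) →L[ℂ] ℂ)
    (M : ι → ι → ℂ) :
    φ M = ∑ a, ∑ b, M a b * φ (Pi.single a (Pi.single b 1)) := by
  have hM : M = ∑ a, ∑ b, M a b • (Pi.single a (Pi.single b (1 : ℂ)) : ι → ι → ℂ) := by
    funext c d
    simp only [Finset.sum_apply, Pi.smul_apply]
    rw [Finset.sum_eq_single c]
    · rw [Finset.sum_eq_single d] <;> simp +contextual [eq_comm]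
    · intro a _ ha
      simp [Pi.single_eq_of_ne ha.symm]
    · simp
  conv_lhs => rw [hM]
  simp only [map_sum, map_smul, smul_eq_mul]

/-- Separation argument. Since `ι` lies in `Type u`, so does the Gram space, which is therefore an
admissible test space for `IsSchurAgler`. -/
theorem IsSchurAgler.mem_closure_aglerCone (hn : 1 ≤ n) {E F : Type u} [NormedAddCommGroup E]
    [InnerProductSpace ℂ E] [CompleteSpace E] [NormedAddCommGroup F] [InnerProductSpace ℂ F]
    [CompleteSpace F] {Θ : (Fin n → ℂ) → (E →L[ℂ] F)} (hΘ : IsSchurAgler Θ)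
    {ι : Type u} [Fintype ι] (x : ι → polydisc n) (η : ι → F) :
    (fun a b => inner ℂ (η a) (η b)
      - inner ℂ ((Θ (x a).1).adjoint (η a)) ((Θ (x b).1).adjoint (η b)))
      ∈ closure (aglerCone x) := by
  classical
  by_contra hQ
  set Q : ι → ι → ℂ := fun a b => inner ℂ (η a) (η b)
      - inner ℂ ((Θ (x a).1).adjoint (η a)) ((Θ (x b).1).adjoint (η b)) with hQdef
  obtain ⟨φ, u, hφQ, hφC⟩ := RCLike.geometric_hahn_banach_point_closed (𝕜 := ℂ)
    (convex_aglerCone x).closure isClosed_closure hQ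
  have h0 : u < 0 := by
    have := hφC 0 (subset_closure ⟨fun _ _ _ => 0, fun _ => isPosScalar_zero, by simp⟩)
    simpa using this
  have hpos : ∀ M ∈ aglerCone x, 0 ≤ (φ M).re := by
    intro M hM
    by_contra! hneg
    -- The scale `u / Re φ(M)` would bring `Re φ` to exactly `u`, against the strict bound on the
    -- cone.
    have h1 := hφC _ (subset_closure (smul_mem_aglerCone x hM
      (div_nonneg_of_nonpos h0.le hneg.le)))
    have h2 : (fun a b => ((u / (φ M).re : ℝ) : ℂ) * M a b) = ((u / (φ M).re : ℝ) : ℂ) • M := rfl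
    rw [h2, map_smul, smul_eq_mul] at h1
    change u < (((u / (φ M).re : ℝ) : ℂ) * φ M).re at h1
    rw [Complex.re_ofReal_mul, div_mul_cancel₀ _ hneg.ne] at h1
    exact lt_irrefl _ h1
  set p : ι → ι → ℂ := fun a b => φ (Pi.single a (Pi.single b 1)) with hp
  -- The Hermitian part of the matrix of `φ`: on Hermitian matrices it represents `Re φ`, the only
  -- part that separation controls.
  set P : ι → ι → ℂ := fun a b => (p a b + conj (p b a)) / 2 with hP
  have hherm : ∀ M : ι → ι → ℂ, (∀ a b, conj (M a b) = M b a) →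
      ∑ a, ∑ b, M a b * P a b = ((φ M).re : ℂ) := by
    intro M hM
    have h1 := clm_eq_sum φ M
    have h2 : conj (φ M) = ∑ a, ∑ b, M a b * conj (p b a) := by
      rw [h1, Finset.sum_comm]
      simp only [map_sum, map_mul, hM, hp]
    rw [Complex.re_eq_add_conj, h2, h1, ← Finset.sum_add_distrib, Finset.sum_div]
    refine Finset.sum_congr rfl fun a _ => ?_
    rw [← Finset.sum_add_distrib, Finset.sum_div]
    refine Finset.sum_congr rfl fun b _ => ?_
    simp only [hP, hp]
    ring
  have hPpos : IsPosScalar P := isPosScalar_of_fintype fun w => by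
    have h1 := hherm (fun a b => conj (w a) * w b) fun a b => by simp [mul_comm]
    have h2 : ∑ a, ∑ b, conj (w a) * P a b * w b = ((φ fun a b => conj (w a) * w b).re : ℂ) := by
      rw [← h1]
      exact Finset.sum_congr rfl fun a _ => Finset.sum_congr rfl fun b _ => by ring
    rw [h2]
    exact Complex.zero_le_real.2 (hpos _ (rank_one_mem_aglerCone x hn w))
  obtain ⟨H, _, _, _, f, hf⟩ := hPpos.exists_gram
  have hnorm : ∀ c : ι → ℂ, ((‖∑ b, c b • f b‖ ^ 2 : ℝ) : ℂ)
      = ∑ a, ∑ b, conj (c a) * c b * P a b := by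
    intro c
    have h2 : ((‖∑ b, c b • f b‖ ^ 2 : ℝ) : ℂ) = inner ℂ (∑ b, c b • f b) (∑ b, c b • f b) := by
      rw [inner_self_eq_norm_sq_to_K]; norm_cast
    rw [h2, sum_inner]
    simp only [inner_sum, inner_smul_left, inner_smul_right, ← hf]
    exact Finset.sum_congr rfl fun a _ => Finset.sum_congr rfl fun b _ => by ring
  -- Nonnegativity of `Re φ` on `(1 - x_a conj x_b)` times a rank one matrix is exactly this
  -- contractivity.
  have hcontr : ∀ i (c : ι → ℂ), ‖∑ b, c b • conj ((x b).1 i) • f b‖ ≤ ‖∑ b, c b • f b‖ := by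
    intro i c
    have hM := hpos _ (one_sub_mul_mem_aglerCone x i (isPosScalar_rank_one c))
    have h1 := hherm (fun a b => (1 - (x a).1 i * conj ((x b).1 i)) * (conj (c a) * c b))
      fun a b => by simp only [map_mul, map_sub, map_one, Complex.conj_conj]; ring
    have h2 : ((‖∑ b, c b • f b‖ ^ 2 - ‖∑ b, c b • conj ((x b).1 i) • f b‖ ^ 2 : ℝ) : ℂ)
        = ((φ fun a b => (1 - (x a).1 i * conj ((x b).1 i)) * (conj (c a) * c b)).re : ℂ) := by
      rw [← h1, Complex.ofReal_sub, hnorm]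
      simp only [smul_smul]
      rw [hnorm fun b => c b * conj ((x b).1 i), ← Finset.sum_sub_distrib]
      refine Finset.sum_congr rfl fun a _ => ?_
      rw [← Finset.sum_sub_distrib]
      refine Finset.sum_congr rfl fun b _ => ?_
      simp only [map_mul, Complex.conj_conj]
      ring
    have h3 := Complex.ofReal_injective h2
    refine le_of_sq_le_sq ?_ (norm_nonneg _)
    linarith
  have hle := hΘ.re_sum_le x f hcontr η
  have h1 := hherm Q fun a b => by simp only [hQdef, map_sub, inner_conj_symm]
  have h2 : ∑ a, ∑ b, Q a b * P a b = (∑ a, ∑ b, inner ℂ (η a) (η b) * inner ℂ (f a) (f b))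
      - ∑ a, ∑ b, inner ℂ ((Θ (x a).1).adjoint (η a)) ((Θ (x b).1).adjoint (η b))
        * inner ℂ (f a) (f b) := by
    rw [← Finset.sum_sub_distrib]
    refine Finset.sum_congr rfl fun a _ => ?_
    rw [← Finset.sum_sub_distrib]
    refine Finset.sum_congr rfl fun b _ => ?_
    rw [← hf, hQdef]
    ring
  have h3 := congrArg Complex.re (h1.symm.trans h2)
  rw [Complex.ofReal_re, Complex.sub_re] at h3
  have h4 : (φ Q).re < u := hφQ
  linarith

end Cone

/-! ### Agler decompositions -/

section AglerDecomposition

variable {n : ℕ}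

theorem IsPosScalar.diag_nonneg {Y : Type*} {l : Y → Y → ℂ} (hl : IsPosScalar l) (a : Y) :
    0 ≤ l a a := by
  simpa using hl 1 (fun _ => a) fun _ => 1

theorem IsPosScalar.norm_le {Y : Type*} {l : Y → Y → ℂ} (hl : IsPosScalar l) (a b : Y) :
    ‖l a b‖ ≤ (l a a).re + (l b b).re := by
  obtain ⟨G, _, _, _, f, hf⟩ := hl.exists_gram
  have h : ∀ c, (l c c).re = ‖f c‖ ^ 2 := fun c => by
    rw [hf]; exact inner_self_eq_norm_sq (𝕜 := ℂ) _
  rw [h, h, hf]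
  refine (norm_inner_le_norm _ _).trans ?_
  nlinarith [sq_nonneg (‖f a‖ - ‖f b‖), sq_nonneg ‖f a‖, sq_nonneg ‖f b‖]

theorem one_sub_mul_conj_self (z : ℂ) : 1 - z * conj z = ((1 - ‖z‖ ^ 2 : ℝ) : ℂ) := by
  rw [Complex.mul_conj, Complex.normSq_eq_norm_sq]; push_cast; ring

theorem one_sub_norm_sq_pos (z : polydisc n) (i : Fin n) : 0 < 1 - ‖z.1 i‖ ^ 2 := by
  have := z.2 i
  nlinarith [norm_nonneg (z.1 i)]

theorem exists_approx_of_mem_closure {Y : Type u} (x : Y → polydisc n) (Q : Y → Y → ℂ)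
    (s : Finset Y)
    (hQ : (fun a b : s => Q a b) ∈ closure (aglerCone fun a : s => x a)) {ε : ℝ} (hε : 0 < ε) :
    ∃ l : Fin n → Y → Y → ℂ, (∀ i, IsPosScalar (l i)) ∧ ∀ a ∈ s, ∀ b ∈ s,
      ‖Q a b - ∑ i, (1 - (x a).1 i * conj ((x b).1 i)) * l i a b‖ ≤ ε := by
  classical
  obtain ⟨M, ⟨l, hl, hM⟩, hdist⟩ := Metric.mem_closure_iff.1 hQ ε hε
  refine ⟨fun i a b => if h : a ∈ s ∧ b ∈ s then l i ⟨a, h.1⟩ ⟨b, h.2⟩ else 0, fun i => ?_, ?_⟩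
  · intro m y v
    by_cases hs : s.Nonempty
    · obtain ⟨a₀, ha₀⟩ := hs
      -- Points outside `s` are sent to an arbitrary `a₀` and given weight zero.
      refine (hl i m (fun j => if h : y j ∈ s then ⟨y j, h⟩ else ⟨a₀, ha₀⟩)
        fun j => if y j ∈ s then v j else 0).trans_eq ?_
      refine Finset.sum_congr rfl fun j _ => Finset.sum_congr rfl fun k _ => ?_
      by_cases h1 : y j ∈ s <;> by_cases h2 : y k ∈ s <;> simp [h1, h2]
    · rw [Finset.not_nonempty_iff_eq_empty] at hs
      subst hs
      simp
  · intro a ha b hb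
    have h1 := (norm_le_pi_norm (((fun a b : s => Q a b) - M) ⟨a, ha⟩) ⟨b, hb⟩).trans
      (norm_le_pi_norm ((fun a b : s => Q a b) - M) ⟨a, ha⟩)
    rw [← dist_eq_norm] at h1
    have h2 := h1.trans hdist.le
    simp only [Pi.sub_apply, hM] at h2
    simpa [ha, hb] using h2

/-- Approximate decompositions over finite sets yield an exact decomposition. -/
theorem mem_aglerCone_of_finite {Y : Type u} (x : Y → polydisc n) (Q : Y → Y → ℂ)
    (hQ : ∀ s : Finset Y, (fun a b : s => Q a b) ∈ closure (aglerCone fun a : s => x a)) :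
    Q ∈ aglerCone x := by
  classical
  have hex : ∀ p : Finset Y × ℕ, ∃ l : Fin n → Y → Y → ℂ, (∀ i, IsPosScalar (l i)) ∧
      ∀ a ∈ p.1, ∀ b ∈ p.1,
        ‖Q a b - ∑ i, (1 - (x a).1 i * conj ((x b).1 i)) * l i a b‖ ≤ 1 / ((p.2 : ℝ) + 1) :=
    fun p => exists_approx_of_mem_closure x Q p.1 (hQ p.1) (by positivity)
  choose l hl hlQ using hex
  -- The finite set grows to exhaust `Y` while the second index drives the error `1 / (p.2 + 1)` to
  -- zero.
  let U : Ultrafilter (Finset Y × ℕ) := Ultrafilter.of Filter.atTop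
  have hU : (U : Filter (Finset Y × ℕ)) ≤ Filter.atTop := Ultrafilter.of_le _
  have hmem : ∀ a : Y, ∀ᶠ p in (U : Filter (Finset Y × ℕ)), a ∈ p.1 := fun a =>
    hU ((Filter.eventually_ge_atTop (({a}, 0) : Finset Y × ℕ)).mono fun p hp =>
      hp.1 (Finset.mem_singleton_self a))
  -- On the diagonal all summands are nonnegative, so each is bounded by the whole; together with
  -- `IsPosScalar.norm_le` this confines every entry to a compact disc.
  have hdiag : ∀ (a : Y) (p : Finset Y × ℕ), a ∈ p.1 → ∀ i,
      (l p i a a).re ≤ (‖Q a a‖ + 1) / (1 - ‖(x a).1 i‖ ^ 2) := by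
    intro a p ha i
    rw [le_div_iff₀ (one_sub_norm_sq_pos _ _)]
    have h1 := hlQ p a ha a ha
    have h2 : ∀ j, 0 ≤ (1 - ‖(x a).1 j‖ ^ 2) * (l p j a a).re := fun j =>
      mul_nonneg (one_sub_norm_sq_pos _ _).le (Complex.le_def.1 ((hl p j).diag_nonneg a)).1
    have h3 : (∑ j, (1 - (x a).1 j * conj ((x a).1 j)) * l p j a a).re
        = ∑ j, (1 - ‖(x a).1 j‖ ^ 2) * (l p j a a).re := by
      rw [Complex.re_sum]
      refine Finset.sum_congr rfl fun j _ => ?_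
      rw [one_sub_mul_conj_self, Complex.re_ofReal_mul]
    have h4 := Finset.single_le_sum (fun j _ => h2 j) (Finset.mem_univ i)
    rw [← h3] at h4
    have h5 : ‖∑ j, (1 - (x a).1 j * conj ((x a).1 j)) * l p j a a‖ ≤ ‖Q a a‖ + 1 := by
      have h6 : (1 : ℝ) / ((p.2 : ℝ) + 1) ≤ 1 := by
        rw [div_le_one (by positivity)]
        linarith [(Nat.cast_nonneg p.2 : (0 : ℝ) ≤ p.2)]
      have h7 := norm_sub_norm_le (∑ j, (1 - (x a).1 j * conj ((x a).1 j)) * l p j a a) (Q a a)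
      rw [norm_sub_rev] at h7
      linarith
    have h8 := Complex.re_le_norm (∑ j, (1 - (x a).1 j * conj ((x a).1 j)) * l p j a a)
    linarith [mul_comm (1 - ‖(x a).1 i‖ ^ 2) (l p i a a).re]
  have hlim : ∀ (i : Fin n) (a b : Y), ∃ c : ℂ,
      Filter.Tendsto (fun p => l p i a b) (U : Filter (Finset Y × ℕ)) (nhds c) := by
    intro i a b
    obtain ⟨c, -, hc⟩ := (isCompact_closedBall (0 : ℂ)
      ((‖Q a a‖ + 1) / (1 - ‖(x a).1 i‖ ^ 2)
        + (‖Q b b‖ + 1) / (1 - ‖(x b).1 i‖ ^ 2))).ultrafilter_le_nhds'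
      (U.map fun p => l p i a b) (((hmem a).and (hmem b)).mono fun p hp => by
        refine mem_closedBall_zero_iff.2 (((hl p i).norm_le a b).trans ?_)
        exact add_le_add (hdiag a p hp.1 i) (hdiag b p hp.2 i))
    exact ⟨c, hc⟩
  choose l' hl' using hlim
  refine ⟨l', fun i => isPosScalar_of_tendsto (fun p => hl p i) fun a b => hl' i a b,
    fun a b => ?_⟩
  have h1 : Filter.Tendsto
      (fun p => Q a b - ∑ i, (1 - (x a).1 i * conj ((x b).1 i)) * l p i a b)
      (U : Filter (Finset Y × ℕ))
      (nhds (Q a b - ∑ i, (1 - (x a).1 i * conj ((x b).1 i)) * l' i a b)) :=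
    (tendsto_finsetSum _ fun i _ => (hl' i a b).const_mul _).const_sub _
  have h2 : Filter.Tendsto
      (fun p => Q a b - ∑ i, (1 - (x a).1 i * conj ((x b).1 i)) * l p i a b)
      (U : Filter (Finset Y × ℕ)) (nhds 0) := by
    refine squeeze_zero_norm' (a := fun p : Finset Y × ℕ => 1 / ((p.2 : ℝ) + 1)) ?_ ?_
    · filter_upwards [hmem a, hmem b] with p ha hb
      exact hlQ p a ha b hb
    · have h3 : Filter.Tendsto (fun p : Finset Y × ℕ => p.2) Filter.atTop Filter.atTop := by
        rw [← Filter.prod_atTop_atTop_eq]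
        exact Filter.tendsto_snd
      exact (tendsto_one_div_add_atTop_nhds_zero_nat.comp h3).mono_left hU
  exact sub_eq_zero.1 (tendsto_nhds_unique h1 h2)

/-- A scalar Agler decomposition of an operator-valued kernel is given by operator kernels. -/
theorem exists_operator_kernels {F : Type u} [NormedAddCommGroup F] [InnerProductSpace ℂ F]
    [CompleteSpace F] (D : polydisc n → polydisc n → (F →L[ℂ] F))
    (hD : (fun p q : polydisc n × F => inner ℂ p.2 (D p.1 q.1 q.2))
      ∈ aglerCone (Prod.fst : polydisc n × F → polydisc n)) :
    ∃ L : Fin n → polydisc n → polydisc n → (F →L[ℂ] F), (∀ i, IsPosKernel (L i)) ∧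
      ∀ z w, D z w = ∑ i, (1 - z.1 i * conj (w.1 i)) • L i z w := by
  obtain ⟨l, hl, hlD⟩ := hD
  choose G i1 i2 i3 g hg using fun i => (hl i).exists_gram
  -- On the diagonal `z = w` the weights `1 - |z_i|²` are positive and the total depends only on `∑
  -- j, c j • η j`. Hence every linear relation among the `η j` passes to the `g i (z, η j)`, giving
  -- linearity, and the same identity gives boundedness.
  have key : ∀ (z : polydisc n) (m : ℕ) (c : Fin m → ℂ) (η : Fin m → F),
      ∑ i, (1 - ‖z.1 i‖ ^ 2) * ‖∑ j, c j • g i (z, η j)‖ ^ 2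
        = (inner ℂ (∑ j, c j • η j) (D z z (∑ j, c j • η j))).re := by
    intro z m c η
    have h1 : ∀ i, ((‖∑ j, c j • g i (z, η j)‖ ^ 2 : ℝ) : ℂ)
        = ∑ j, ∑ k, conj (c j) * c k * l i (z, η j) (z, η k) := by
      intro i
      have h2 : ((‖∑ j, c j • g i (z, η j)‖ ^ 2 : ℝ) : ℂ)
          = inner ℂ (∑ j, c j • g i (z, η j)) (∑ j, c j • g i (z, η j)) := by
        rw [inner_self_eq_norm_sq_to_K]; norm_cast
      rw [h2, sum_inner]
      simp only [inner_sum, inner_smul_left, inner_smul_right, ← hg]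
      exact Finset.sum_congr rfl fun a _ => Finset.sum_congr rfl fun b _ => by ring
    have h3 : inner ℂ (∑ j, c j • η j) (D z z (∑ j, c j • η j))
        = ((∑ i, (1 - ‖z.1 i‖ ^ 2) * ‖∑ j, c j • g i (z, η j)‖ ^ 2 : ℝ) : ℂ) := by
      have h4 : ∀ j k, inner ℂ (η j) (D z z (η k))
          = ∑ i, ((1 - ‖z.1 i‖ ^ 2 : ℝ) : ℂ) * l i (z, η j) (z, η k) := by
        intro j k
        have := hlD (z, η j) (z, η k)
        simp only [one_sub_mul_conj_self] at this
        exact this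
      rw [Complex.ofReal_sum]
      simp only [Complex.ofReal_mul _ (‖_‖ ^ 2), h1, Finset.mul_sum]
      rw [sum_inner, Finset.sum_comm]
      refine Finset.sum_congr rfl fun j _ => ?_
      rw [Finset.sum_comm, map_sum, inner_sum]
      refine Finset.sum_congr rfl fun k _ => ?_
      rw [map_smul, inner_smul_left, inner_smul_right, h4, Finset.mul_sum, Finset.mul_sum]
      exact Finset.sum_congr rfl fun i _ => by ring
    rw [h3, Complex.ofReal_re]
  have hzero : ∀ (z : polydisc n) (m : ℕ) (c : Fin m → ℂ) (η : Fin m → F),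
      ∑ j, c j • η j = 0 → ∀ i, ∑ j, c j • g i (z, η j) = 0 := by
    intro z m c η h i
    have h1 := key z m c η
    rw [h, inner_zero_left, Complex.zero_re, Finset.sum_eq_zero_iff_of_nonneg fun i _ =>
      mul_nonneg (one_sub_norm_sq_pos z i).le (sq_nonneg _)] at h1
    have h2 := (mul_eq_zero.1 (h1 i (Finset.mem_univ i))).resolve_left (one_sub_norm_sq_pos z i).ne'
    exact norm_eq_zero.1 (pow_eq_zero_iff two_ne_zero |>.1 h2)
  let A₀ : ∀ i, polydisc n → F →ₗ[ℂ] G i := fun i z =>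
    { toFun := fun η => g i (z, η)
      map_add' := fun η ξ => by
        have := hzero z 3 ![1, -1, -1] ![η + ξ, η, ξ] (by simp [Fin.sum_univ_three]) i
        simp only [Fin.sum_univ_three, Matrix.cons_val, one_smul, neg_smul] at this
        rw [← sub_eq_zero, ← this]; abel
      map_smul' := fun a η => by
        have := hzero z 2 ![1, -a] ![a • η, η] (by simp [Fin.sum_univ_two]) i
        simp only [Fin.sum_univ_two, Matrix.cons_val_zero, Matrix.cons_val_one, one_smul,
          neg_smul] at this
        rw [RingHom.id_apply, ← sub_eq_zero, ← this]; abel }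
  have hbound : ∀ i (z : polydisc n) (η : F),
      ‖A₀ i z η‖ ≤ √(‖D z z‖ / (1 - ‖z.1 i‖ ^ 2)) * ‖η‖ := by
    intro i z η
    have h1 := key z 1 (fun _ => 1) fun _ => η
    simp only [Fin.sum_univ_one, one_smul] at h1
    have h2 := Finset.single_le_sum (fun j _ =>
      mul_nonneg (one_sub_norm_sq_pos z j).le (sq_nonneg ‖g j (z, η)‖)) (Finset.mem_univ i)
    have h3 : (inner ℂ η (D z z η)).re ≤ ‖D z z‖ * ‖η‖ ^ 2 := by
      refine (Complex.re_le_norm _).trans ((norm_inner_le_norm _ _).trans ?_)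
      nlinarith [(D z z).le_opNorm η, norm_nonneg η]
    refine le_of_sq_le_sq ?_ (by positivity)
    rw [mul_pow, Real.sq_sqrt (div_nonneg (norm_nonneg _) (one_sub_norm_sq_pos z i).le),
      div_mul_eq_mul_div, le_div_iff₀ (one_sub_norm_sq_pos z i), mul_comm]
    exact h2.trans (h1.le.trans h3)
  let A : ∀ i, polydisc n → F →L[ℂ] G i := fun i z => (A₀ i z).mkContinuous _ (hbound i z)
  refine ⟨fun i z w => (A i z).adjoint ∘L A i w, fun i => isPosKernel_adjoint_comp (A i),
    fun z w => ?_⟩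
  ext ξ
  refine ext_inner_left ℂ fun η => ?_
  simp only [sum_apply, smul_apply, inner_sum, inner_smul_right, ContinuousLinearMap.comp_apply,
    ContinuousLinearMap.adjoint_inner_right]
  refine (hlD (z, η) (w, ξ)).trans (Finset.sum_congr rfl fun i _ => ?_)
  rw [hg]
  rfl

/-- The Agler decomposition of a Schur–Agler function. -/
theorem IsSchurAgler.exists_kernels (hn : 1 ≤ n) {E F : Type u} [NormedAddCommGroup E]
    [InnerProductSpace ℂ E] [CompleteSpace E] [NormedAddCommGroup F] [InnerProductSpace ℂ F]
    [CompleteSpace F] {Θ : (Fin n → ℂ) → (E →L[ℂ] F)} (hΘ : IsSchurAgler Θ) :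
    ∃ L : Fin n → polydisc n → polydisc n → (F →L[ℂ] F), (∀ i, IsPosKernel (L i)) ∧
      ∀ z w : polydisc n, ContinuousLinearMap.id ℂ F - Θ z.1 ∘L (Θ w.1).adjoint
        = ∑ i, (1 - z.1 i * conj (w.1 i)) • L i z w := by
  refine exists_operator_kernels
    (fun z w => ContinuousLinearMap.id ℂ F - Θ z.1 ∘L (Θ w.1).adjoint) ?_
  refine mem_aglerCone_of_finite _ _ fun s => ?_
  convert! hΘ.mem_closure_aglerCone hn (fun a : s => a.1.1) fun a : s => a.1.2 using 1
  funext a b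
  simp only [sub_apply, ContinuousLinearMap.id_apply, ContinuousLinearMap.comp_apply,
    inner_sub_right, ContinuousLinearMap.adjoint_inner_left]

end AglerDecomposition

/-! ### The equivalence -/

theorem mainTheorem5 {n : ℕ} (hn : 1 ≤ n) {Estar : Type u}
    [NormedAddCommGroup Estar] [InnerProductSpace ℂ Estar] [CompleteSpace Estar]
    (K : polydisc n → polydisc n → (Estar →L[ℂ] Estar)) (hK : IsPosKernel K) :
    (∃ (E : Type u) (_ : NormedAddCommGroup E) (_ : InnerProductSpace ℂ E) (_ : CompleteSpace E)
        (Θ : (Fin n → ℂ) → (E →L[ℂ] Estar)),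
        IsSchurAgler Θ ∧ ∀ z w : polydisc n, K z w = deBrangesRovnyakKernel Θ z w) ↔
      ((∃ L : Fin n → polydisc n → polydisc n → (Estar →L[ℂ] Estar),
          (∀ i, IsPosKernel (L i)) ∧
          ∀ z w : polydisc n, K z w =
            ∑ i, (1 / ∏ j ∈ Finset.univ.erase i, (1 - z.1 j * conj (w.1 j))) • L i z w) ∧
        IsPosKernel fun z w : polydisc n =>
          ContinuousLinearMap.id ℂ Estar - (szegoKernel z w)⁻¹ • K z w) := by
  constructor
  · rintro ⟨E, _, _, _, Θ, hΘ, hKΘ⟩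
    constructor
    · obtain ⟨L, hL, hdec⟩ := hΘ.exists_kernels hn
      refine ⟨L, hL, fun z w => ?_⟩
      rw [hKΘ, deBrangesRovnyakKernel, hdec, Finset.smul_sum]
      refine Finset.sum_congr rfl fun i _ => ?_
      rw [smul_smul, ← szegoKernel_inv_mul, ← mul_assoc,
        mul_inv_cancel₀ (szegoKernel_ne_zero z w), one_mul]
    -- Here `I - 𝕊ₙ⁻¹ K` is `Θ(z) Θ(w)^*`, already in factored form.
    · convert! isPosKernel_adjoint_comp fun z : polydisc n => (Θ z.1).adjoint using 3 with z w
      rw [hKΘ, deBrangesRovnyakKernel, smul_smul, inv_mul_cancel₀ (szegoKernel_ne_zero z w),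
        one_smul, sub_sub_cancel, ContinuousLinearMap.adjoint_adjoint]
  · rintro ⟨⟨L, hL, hKL⟩, hpos⟩
    exact exists_isSchurAgler_of_kernels K L hL hKL hpos
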